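/- Let $d\ge 1$ and let $P\subset\mathbb{R}^d$ be a closed convex cone with $P-P=\mathbb{R}^d$ and $P\cap -P=\{0\}$. Let $S(P^*)=\{\lambda\in\mathbb{R}^d:\|\lambda\|=1,\ \langle\lambda|x\rangle\ge 0\ \text{for all}\ x\in P\}$. Let $Y_u$ be the space of closed sets $A\subset\mathbb{R}^d$ with $-P+A\subset A$, $A\ne\emptyset$, $A\ne\mathbb{R}^d$, with the Fell topology and the action $(x,A)\mapsto A+x$ of $\mathbb{R}^d$, and let $X_u=\{A\in Y_u:0\in A\}$. For $\lambda\in S(P^*)$ let $H^\lambda=\{x\in\mathbb{R}^d:\langle\lambda|x\rangle\le 0\}$ and $Y_u^\lambda=\{H^\lambda+t\lambda:t\in\mathbb{R}\}$. Let $\mu$ be a nonzero $\mathbb{R}^d$-invariant Radon measure on $Y_u$. For $a\in P$ let $V^\mu_a$ be the isometry of $L^2(X_u,\mu)$ given by $(V_a^\mu f)(A)=f(A-a)$ if $A-a\in X_u$ and $(V_a^\mu f)(A)=0$ otherwise, and let $\eta_a=1_{X_u\setminus(X_u+a)}\in \ker (V_a^{\mu})^*$. Let $E^\mu$ be the CAR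 product system of $V=V^\mu$: its fibre $E^\mu(a)$ is the antisymmetric Fock space $\Gamma_a(\ker V_a^*)$, regarded as a subspace of $\Gamma_a(L^2(X_u,\mu))$, with product determined by $$(\xi_1\wedge\dots\wedge\xi_m)\cdot(\zeta_1\wedge\dots\wedge\zeta_n)=V_a\zeta_1\wedge\dots\wedge V_a\zeta_n\wedge\xi_1\wedge\dots\wedge\xi_m$$ for $\xi_i\in\ker V_a^*$, $\zeta_j\in\ker V_b^*$ (empty wedge products being the vacuum $\Omega$). A unit of $E^\mu$ is a weakly measurable family $u_a\in E^\mu(a)$, $a\in P$, with $u_a\neq 0$ and $u_a\cdot u_b=u_{a+b}$ for all $a,b\in P$. For $a\in P$ and $\xi\in\ker V_a^*$, the exponential $\mathrm{Exp}_a(\xi)\in E^\mu(a)$ is taken in the one-parameter product system $\{E^\mu(ta)\}_{t\ge0}$ relative to the vacuum unit. Let $(b_s)_{0\le s\le 1}$, with increments $b(r,s)$, be the unique coherent section of additive decomposable vectors with $b_1=\xi$; that is, $b_s\in E^\mu(sa)$ is additive decomposable, $b(r,s)\in E^\mu((s-r)a)$, and $b_s=b_r\cdot\Omega+\Omega\cdot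 b(r,s)$ for $0\le r\le s\le1$. Here $b\in E^\mu(ta)$ is additive decomposable if $b\perp\Omega$ and for every $0\le s\le t$ there are $b'\in E^\mu(sa)$ and $b''\in E^\mu((t-s)a)$, both orthogonal to $\Omega$, with $b=b'\cdot\Omega+\Omega\cdot b''$. Set $x^{(0)}_s=\Omega$, $x^{(1)}_s=b_s$ and, for $n\ge2$, let $x^{(n)}_s=\int_0^s x^{(n-1)}_r\,db_r$ be the It\^o integral $$\lim_{k\to\infty}\sum_{i=0}^{k-1}x^{(n-1)}_{is/k}\cdot b\big(\tfrac{is}{k},\tfrac{(i+1)s}{k}\big)\cdot\Omega .$$ Then $\mathrm{Exp}_a(\xi)=\sum_{n\ge0}x^{(n)}_1$. Then the following are equivalent: (i) $\{\mathrm{Exp}_a(1_{X_u\setminus (X_u+a)})\}_{a\in P}$ is a unit of $E^\mu$; (ii) there exists $\lambda\in S(P^*)$ such that $\mathrm{supp}(\mu)=Y_u^\lambda$. -/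

import Mathlib

open scoped NNReal Pointwise ComplexConjugate InnerProductSpace Topology
open MeasureTheory Filter

set_option linter.unusedSectionVars false

noncomputable section

namespace CARFlow

/-- The Euclidean space `ℝ^d`. -/
abbrev Euc (d : ℕ) : Type := EuclideanSpace ℝ (Fin d)

section Fock

open scoped ComplexOrder

variable {H : Type*} [NormedAddCommGroup H] [InnerProductSpace ℂ H]

/-- The Gram determinant `det (⟪vᵢ, wⱼ⟫)` of two finite sequences of vectors, and `0` if their
lengths differ: the inner product of `v₁ ∧ ⋯ ∧ vₙ` and `w₁ ∧ ⋯ ∧ wₘ`. -/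
def wedgeKernel (v w : List H) : ℂ :=
  if h : v.length = w.length then
    Matrix.det (Matrix.of fun i j : Fin v.length => ⟪v.get i, w.get (Fin.cast h j)⟫_ℂ)
  else 0

lemma wedgeKernel_ofFn {n : ℕ} (f g : Fin n → H) :
    wedgeKernel (List.ofFn f) (List.ofFn g) = Matrix.det (Matrix.of fun i j => ⟪f i, g j⟫_ℂ) := by
  have h : (List.ofFn f).length = (List.ofFn g).length := by simp
  rw [wedgeKernel, dif_pos h]
  rw [← Matrix.det_submatrix_equiv_self (finCongr (List.length_ofFn (f := f)))]
  congr 1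
  ext i j
  simp
  rfl

lemma wedgeKernel_of_length_ne {v w : List H} (h : v.length ≠ w.length) : wedgeKernel v w = 0 :=
  dif_neg h

lemma exists_eq_ofFn {α : Type*} {n : ℕ} {l : List α} (h : l.length = n) : ∃ f : Fin n → α, l = List.ofFn f := by
  subst h
  exact ⟨l.get, (List.ofFn_get l).symm⟩

lemma wedgeKernel_conj_symm (v w : List H) : conj (wedgeKernel w v) = wedgeKernel v w := by
  by_cases h : v.length = w.length
  · obtain ⟨m, hm⟩ : ∃ m, w.length = m := ⟨_, rfl⟩
    obtain ⟨f, rfl⟩ := exists_eq_ofFn (h.trans hm)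
    obtain ⟨g, rfl⟩ := exists_eq_ofFn hm
    rw [wedgeKernel_ofFn, wedgeKernel_ofFn, RingHom.map_det, ← Matrix.det_transpose]
    congr 1
    ext i j
    simp
  · rw [wedgeKernel_of_length_ne h, wedgeKernel_of_length_ne (Ne.symm h), map_zero]

lemma posSemidef_prod_inner {ι : Type*} [Finite ι] {n : ℕ} (f : ι → Fin n → H) (s : Finset (Fin n)) :
    (Matrix.of fun i j : ι => ∏ a ∈ s, ⟪f i a, f j a⟫_ℂ).PosSemidef := by
  classical
  induction s using Finset.induction_on with
  | empty =>
    have e : (Matrix.of fun i j : ι => ∏ a ∈ (∅ : Finset (Fin n)), ⟪f i a, f j a⟫_ℂ)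
        = Matrix.gram ℂ (fun _ : ι => (1 : ℂ)) := by
      ext i j
      simp [Matrix.gram]
    rw [e]
    exact Matrix.posSemidef_gram ℂ (fun _ : ι => (1 : ℂ))
  | insert a s ha ih =>
    have e : (Matrix.of fun i j : ι => ∏ b ∈ insert a s, ⟪f i b, f j b⟫_ℂ)
        = (Matrix.gram ℂ (fun i : ι => f i a)).hadamard
          (Matrix.of fun i j : ι => ∏ b ∈ s, ⟪f i b, f j b⟫_ℂ) := by
      ext i j
      simp [Matrix.gram, Finset.prod_insert ha]
    rw [e]
    exact (Matrix.posSemidef_gram ℂ (fun i : ι => f i a)).hadamard ih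

lemma sum_sign_prod_inner {n : ℕ} (M : Matrix (Fin n) (Fin n) ℂ) :
    ∑ σ : Equiv.Perm (Fin n), ∑ τ : Equiv.Perm (Fin n),
      ((Equiv.Perm.sign σ : ℤ) : ℂ) * ((Equiv.Perm.sign τ : ℤ) : ℂ) * ∏ a, M (σ a) (τ a)
      = (n.factorial : ℂ) * M.det := by
  have : ∀ σ : Equiv.Perm (Fin n), ∑ τ : Equiv.Perm (Fin n),
      ((Equiv.Perm.sign σ : ℤ) : ℂ) * ((Equiv.Perm.sign τ : ℤ) : ℂ) * ∏ a, M (σ a) (τ a)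
      = M.det := by
    intro σ
    have h1 : (M.submatrix σ id).det = ∑ τ : Equiv.Perm (Fin n),
        ((Equiv.Perm.sign τ : ℤ) : ℂ) * ∏ a, M (σ a) (τ a) := by
      rw [← Matrix.det_transpose, Matrix.det_apply']
      rfl
    simp_rw [mul_assoc]
    rw [← Finset.mul_sum, ← h1, Matrix.det_permute]
    rw [← mul_assoc, ← Int.cast_mul, ← Units.val_mul, Int.units_mul_self]
    simp
  rw [Finset.sum_congr rfl (fun σ _ => this σ)]
  simp [Fintype.card_perm]

lemma wedgeKernel_sum_nonneg_of_length (n : ℕ) (s : Finset (List H)) (c : List H → ℂ)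
    (hs : ∀ l ∈ s, l.length = n) :
    0 ≤ ∑ v ∈ s, ∑ w ∈ s, conj (c v) * c w * wedgeKernel v w := by
  classical
  choose! f hf using fun (l : List H) (h : l.length = n) => exists_eq_ofFn h
  have hpsd := posSemidef_prod_inner
    (fun (p : s × Equiv.Perm (Fin n)) (a : Fin n) => f p.1 (p.2 a)) Finset.univ
  have h0 := hpsd.dotProduct_mulVec_nonneg (fun p => c p.1 * ((Equiv.Perm.sign p.2 : ℤ) : ℂ))
  have key : (star (fun p : s × Equiv.Perm (Fin n) => c p.1 * ((Equiv.Perm.sign p.2 : ℤ) : ℂ)) ⬝ᵥ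
      (Matrix.of fun i j : s × Equiv.Perm (Fin n) =>
        ∏ a, ⟪f i.1 (i.2 a), f j.1 (j.2 a)⟫_ℂ).mulVec
        (fun p => c p.1 * ((Equiv.Perm.sign p.2 : ℤ) : ℂ)))
      = (n.factorial : ℂ) * ∑ v ∈ s, ∑ w ∈ s, conj (c v) * c w * wedgeKernel v w := by
    rw [← Finset.sum_coe_sort s]
    simp_rw [← Finset.sum_coe_sort s (fun w => conj (c _) * c w * wedgeKernel _ w)]
    rw [Finset.mul_sum]
    simp only [dotProduct, Matrix.mulVec, Fintype.sum_prod_type, Finset.mul_sum]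
    refine Finset.sum_congr rfl fun v _ => ?_
    rw [Finset.sum_comm]
    refine Finset.sum_congr rfl fun w _ => ?_
    have hk : wedgeKernel (v : List H) (w : List H)
        = Matrix.det (Matrix.of fun i j => ⟪f v i, f w j⟫_ℂ) := by
      conv_lhs => rw [hf v (hs v v.2), hf w (hs w w.2)]
      exact wedgeKernel_ofFn _ _
    rw [hk, mul_left_comm, ← sum_sign_prod_inner, Finset.mul_sum]
    refine Finset.sum_congr rfl fun σ _ => ?_
    rw [Finset.mul_sum]
    refine Finset.sum_congr rfl fun τ _ => ?_
    simp
    ring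
  rw [key] at h0
  have hn : (0 : ℂ) < (n.factorial : ℂ) := by exact_mod_cast n.factorial_pos
  refine le_of_mul_le_mul_left ?_ hn
  rwa [mul_zero]

lemma wedgeKernel_sum_nonneg (s : Finset (List H)) (c : List H → ℂ) :
    0 ≤ ∑ v ∈ s, ∑ w ∈ s, conj (c v) * c w * wedgeKernel v w := by
  classical
  have : ∑ v ∈ s, ∑ w ∈ s, conj (c v) * c w * wedgeKernel v w
      = ∑ n ∈ s.image List.length, ∑ v ∈ s with v.length = n, ∑ w ∈ s with w.length = n,
        conj (c v) * c w * wedgeKernel v w := by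
    rw [← Finset.sum_fiberwise_of_maps_to (t := s.image List.length) (g := List.length)
      (fun l hl => Finset.mem_image_of_mem _ hl)]
    refine Finset.sum_congr rfl fun n _ => Finset.sum_congr rfl fun v hv => ?_
    rw [Finset.sum_filter]
    refine Finset.sum_congr rfl fun w _ => ?_
    split_ifs with h
    · rfl
    · rw [wedgeKernel_of_length_ne, mul_zero]
      rw [(Finset.mem_filter.mp hv).2]
      exact Ne.symm h
  rw [this]
  refine Finset.sum_nonneg fun n _ => wedgeKernel_sum_nonneg_of_length n _ c ?_
  intro l hl
  exact (Finset.mem_filter.mp hl).2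

lemma det_eq_zero_of_corners {n a b : ℕ} (ha : a ≤ n) (hb : b ≤ n) (hab : a ≠ b)
    (M : Matrix (Fin n) (Fin n) ℂ)
    (h1 : ∀ i j : Fin n, i.1 < a → b ≤ j.1 → M i j = 0)
    (h2 : ∀ i j : Fin n, a ≤ i.1 → j.1 < b → M i j = 0) : M.det = 0 := by
  classical
  rw [Matrix.det_apply]
  refine Finset.sum_eq_zero fun σ _ => ?_
  by_contra hne
  have hz : ∀ i, M (σ i) i ≠ 0 := by
    intro i hi
    have hp : ∏ k, M (σ k) k = 0 := Finset.prod_eq_zero (Finset.mem_univ i) hi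
    exact hne (by rw [hp, smul_zero])
  have hiff : ∀ i : Fin n, (σ i).1 < a ↔ i.1 < b := by
    intro i
    constructor
    · intro h
      by_contra h'
      exact hz i (h1 _ _ h (not_lt.mp h'))
    · intro h
      by_contra h'
      exact hz i (h2 _ _ (not_lt.mp h') h)
  have hcard : ∀ c : ℕ, c ≤ n → (Finset.univ.filter fun i : Fin n => i.1 < c).card = c := by
    intro c hc
    rw [Fin.card_filter_val_lt]
    exact min_eq_right hc
  apply hab
  rw [← hcard a ha, ← hcard b hb]
  symm
  refine Finset.card_bij (fun i _ => σ i) ?_ ?_ ?_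
  · intro i hi
    simpa [hiff] using hi
  · intro i _ j _ h
    exact σ.injective h
  · intro j hj
    refine ⟨σ.symm j, ?_, by simp⟩
    have := hiff (σ.symm j)
    simp only [Equiv.apply_symm_apply] at this
    simpa [← this] using hj

lemma wedgeKernel_append (p q p' q' : List H)
    (h1 : ∀ x ∈ p, ∀ y ∈ q', ⟪x, y⟫_ℂ = 0) (h2 : ∀ x ∈ q, ∀ y ∈ p', ⟪x, y⟫_ℂ = 0) :
    wedgeKernel (p ++ q) (p' ++ q') = wedgeKernel p p' * wedgeKernel q q' := by
  by_cases hlen : (p ++ q).length = (p' ++ q').length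
  · by_cases hp : p.length = p'.length
    · have hq : q.length = q'.length := by
        simp only [List.length_append] at hlen
        omega
      obtain ⟨m, hm⟩ : ∃ m, p'.length = m := ⟨_, rfl⟩
      obtain ⟨k, hk⟩ : ∃ k, q'.length = k := ⟨_, rfl⟩
      obtain ⟨f', rfl⟩ := exists_eq_ofFn hm
      obtain ⟨g', rfl⟩ := exists_eq_ofFn hk
      obtain ⟨f, rfl⟩ := exists_eq_ofFn (hp.trans hm)
      obtain ⟨g, rfl⟩ := exists_eq_ofFn (hq.trans hk)
      rw [← List.ofFn_fin_append, ← List.ofFn_fin_append]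
      rw [wedgeKernel_ofFn, wedgeKernel_ofFn, wedgeKernel_ofFn,
        ← Matrix.det_submatrix_equiv_self finSumFinEquiv, ← Matrix.det_fromBlocks_zero₂₁ _ 0]
      congr 1
      ext i j
      rcases i with i | i <;> rcases j with j | j
      · simp
      · simpa using h1 _ (List.mem_ofFn.mpr ⟨i, rfl⟩) _ (List.mem_ofFn.mpr ⟨j, rfl⟩)
      · simpa using h2 _ (List.mem_ofFn.mpr ⟨i, rfl⟩) _ (List.mem_ofFn.mpr ⟨j, rfl⟩)
      · simp
    · rw [wedgeKernel_of_length_ne hp, zero_mul, wedgeKernel, dif_pos hlen]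
      refine det_eq_zero_of_corners (a := p.length) (b := p'.length) (by simp) ?_ hp _ ?_ ?_
      · rw [hlen]; simp
      · intro i j hi hj
        simp only [Matrix.of_apply, List.get_eq_getElem, Fin.val_cast]
        rw [List.getElem_append_left hi, List.getElem_append_right hj]
        exact h1 _ (List.getElem_mem _) _ (List.getElem_mem _)
      · intro i j hi hj
        simp only [Matrix.of_apply, List.get_eq_getElem, Fin.val_cast]
        rw [List.getElem_append_right hi, List.getElem_append_left hj]
        exact h2 _ (List.getElem_mem _) _ (List.getElem_mem _)
  · rw [wedgeKernel_of_length_ne hlen]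
    by_cases hp : p.length = p'.length
    · have hq : q.length ≠ q'.length := by
        simp only [List.length_append] at hlen
        omega
      rw [wedgeKernel_of_length_ne hq, mul_zero]
    · rw [wedgeKernel_of_length_ne hp, zero_mul]


variable (H) in
/-- Formal finite linear combinations of the symbols `v₁ ∧ ⋯ ∧ vₙ`, with `n ≥ 0` and `vᵢ` in `H`. -/
def PreFock : Type _ := List H →₀ ℂ

instance : AddCommGroup (PreFock H) := inferInstanceAs (AddCommGroup (List H →₀ ℂ))
instance : Module ℂ (PreFock H) := inferInstanceAs (Module ℂ (List H →₀ ℂ))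

/-- The symbol `v₁ ∧ ⋯ ∧ vₙ`. -/
def preWedge (v : List H) : PreFock H := Finsupp.single v (1 : ℂ)

lemma PreFock.induction {p : PreFock H → Prop} (x : PreFock H) (h0 : p 0)
    (hadd : ∀ x y, p x → p y → p (x + y)) (hw : ∀ (c : ℂ) (v : List H), p (c • preWedge v)) :
    p x := by
  refine Finsupp.induction_linear (motive := p) x h0 hadd fun v c => ?_
  have : (Finsupp.single v c : List H →₀ ℂ) = c • Finsupp.single v (1 : ℂ) := by simp
  rw [this]
  exact hw c v

/-- The sesquilinear extension of `wedgeKernel`. -/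
def preFockInner (x y : PreFock H) : ℂ :=
  Finsupp.sum x fun v a => Finsupp.sum y fun w b => conj a * b * wedgeKernel v w

/-- The positive semidefinite sesquilinear form on formal linear combinations of wedge products. -/
@[reducible]
def preFockCore : PreInnerProductSpace.Core ℂ (PreFock H) where
  inner := preFockInner
  conj_inner_symm x y := by
    simp only [preFockInner, Finsupp.sum, map_sum, map_mul, Complex.conj_conj,
      wedgeKernel_conj_symm]
    rw [Finset.sum_comm]
    refine Finset.sum_congr rfl fun v _ => Finset.sum_congr rfl fun w _ => ?_
    ring
  re_inner_nonneg x := by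
    have := wedgeKernel_sum_nonneg (Finsupp.support x) (fun v => Finsupp.toFun x v)
    exact (Complex.le_def.mp this).1
  add_left x y z := by
    unfold preFockInner
    rw [← Finsupp.sum_add_index' (f := (x : List H →₀ ℂ)) (g := (y : List H →₀ ℂ))
      (h := fun v a => Finsupp.sum z fun w b => conj a * b * wedgeKernel v w)]
    · rfl
    · intro v
      simp [Finsupp.sum]
    · intro v a b
      simp [Finsupp.sum, add_mul, Finset.sum_add_distrib]
  smul_left x y r := by
    unfold preFockInner
    have : Finsupp.sum (r • (x : List H →₀ ℂ))
        (fun v a => Finsupp.sum y fun w b => conj a * b * wedgeKernel v w) =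
        Finsupp.sum (x : List H →₀ ℂ)
        (fun v a => Finsupp.sum y fun w b => conj (r * a) * b * wedgeKernel v w) :=
      Finsupp.sum_smul_index (fun v => by simp [Finsupp.sum])
    refine Eq.trans this ?_
    simp only [Finsupp.sum, Finset.mul_sum, map_mul]
    refine Finset.sum_congr rfl fun v _ => Finset.sum_congr rfl fun w _ => ?_
    ring

instance : SeminormedAddCommGroup (PreFock H) :=
  InnerProductSpace.Core.toSeminormedAddCommGroup (c := preFockCore)

instance : InnerProductSpace ℂ (PreFock H) := InnerProductSpace.ofCore preFockCore

lemma inner_preWedge (v w : List H) : ⟪preWedge v, preWedge w⟫_ℂ = wedgeKernel v w := by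
  change preFockInner _ _ = _
  unfold preFockInner preWedge
  rw [Finsupp.sum_single_index, Finsupp.sum_single_index] <;> simp [Finsupp.sum]

variable (H) in
/-- The antisymmetric Fock space `Γₐ(H)`: the Hilbert space (the separated completion) spanned by
the wedge products `v₁ ∧ ⋯ ∧ vₙ`, whose inner products are `det (⟪vᵢ, wⱼ⟫)`. -/
abbrev Fock : Type _ := UniformSpace.Completion (PreFock H)

/-- The vector `v₁ ∧ ⋯ ∧ vₙ` of the Fock space. -/
def wedge (v : List H) : Fock H := (preWedge v : PreFock H)

lemma inner_wedge (v w : List H) : ⟪wedge v, wedge w⟫_ℂ = wedgeKernel v w := by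
  rw [wedge, wedge, UniformSpace.Completion.inner_coe, inner_preWedge]

variable (H) in
/-- The vacuum vector `Ω`, the empty wedge product. -/
def vacuum : Fock H := wedge []

variable {K : Type*} [NormedAddCommGroup K] [InnerProductSpace ℂ K]

/-- The linear map of formal combinations which applies `F` to the symbols. -/
def preFockLift {W : Type*} [AddCommGroup W] [Module ℂ W] (F : List H → W) : PreFock H →ₗ[ℂ] W :=
  Finsupp.linearCombination ℂ F

lemma preFockLift_preWedge {W : Type*} [AddCommGroup W] [Module ℂ W] (F : List H → W) (v : List H) :
    preFockLift F (preWedge v) = F v :=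
  (Finsupp.linearCombination_single ℂ 1 v).trans (one_smul _ _)

variable [CompleteSpace H]

/-- The orthogonal projection onto the kernel of `T*`, that is `1 - T T*`, for an isometry `T`. -/
def kerProj (T : H →ₗᵢ[ℂ] H) (v : H) : H :=
  v - T (T.toContinuousLinearMap.adjoint v)

lemma adjoint_apply_isometry (T : H →ₗᵢ[ℂ] H) (v : H) :
    T.toContinuousLinearMap.adjoint (T v) = v := by
  refine ext_inner_left ℂ fun w => ?_
  rw [ContinuousLinearMap.adjoint_inner_right]
  exact T.inner_map_map w v

lemma kerProj_of_mem (T : H →ₗᵢ[ℂ] H) {v : H} (hv : T.toContinuousLinearMap.adjoint v = 0) :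
    kerProj T v = v := by simp [kerProj, hv]

lemma adjoint_kerProj (T : H →ₗᵢ[ℂ] H) (v : H) :
    T.toContinuousLinearMap.adjoint (kerProj T v) = 0 := by
  rw [kerProj, map_sub, adjoint_apply_isometry, sub_self]

lemma inner_kerProj_isometry (T : H →ₗᵢ[ℂ] H) (v w : H) : ⟪kerProj T v, T w⟫_ℂ = 0 := by
  have := ContinuousLinearMap.adjoint_inner_left T.toContinuousLinearMap w (kerProj T v)
  rw [adjoint_kerProj, inner_zero_left] at this
  exact this.symm

lemma inner_isometry_kerProj (T : H →ₗᵢ[ℂ] H) (v w : H) : ⟪T w, kerProj T v⟫_ℂ = 0 :=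
  inner_eq_zero_symm.mp (inner_kerProj_isometry T v w)

lemma inner_kerProj_left (T : H →ₗᵢ[ℂ] H) (v w : H) :
    ⟪kerProj T v, w⟫_ℂ = ⟪kerProj T v, kerProj T w⟫_ℂ := by
  conv_lhs => rw [show w = kerProj T w + T (T.toContinuousLinearMap.adjoint w) by simp [kerProj]]
  rw [inner_add_right, inner_kerProj_isometry, add_zero]

lemma inner_kerProj_right (T : H →ₗᵢ[ℂ] H) (v w : H) :
    ⟪v, kerProj T w⟫_ℂ = ⟪kerProj T v, kerProj T w⟫_ℂ := by
  rw [← inner_conj_symm, inner_kerProj_left, inner_conj_symm]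

/-- Second quantisation of the projection `1 - T T*`, on formal combinations. -/
def preProj (T : H →ₗᵢ[ℂ] H) : PreFock H →ₗ[ℂ] PreFock H :=
  preFockLift fun v => preWedge (v.map (kerProj T))

/-- The product `(ξ₁ ∧ ⋯ ∧ ξₘ, η₁ ∧ ⋯ ∧ ηₙ) ↦ Tη₁ ∧ ⋯ ∧ Tηₙ ∧ ξ₁ ∧ ⋯ ∧ ξₘ`, where the `ξᵢ` are first
projected onto the kernel of `T*`, on formal combinations. -/
def preFockMul (T : H →ₗᵢ[ℂ] H) : PreFock H →ₗ[ℂ] PreFock H →ₗ[ℂ] PreFock H :=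
  preFockLift fun v => preFockLift fun w => preWedge (w.map T ++ v.map (kerProj T))

lemma wedgeKernel_map_isometry (T : H →ₗᵢ[ℂ] H) (v w : List H) :
    wedgeKernel (v.map T) (w.map T) = wedgeKernel v w := by
  by_cases h : v.length = w.length
  · obtain ⟨m, hm⟩ : ∃ m, w.length = m := ⟨_, rfl⟩
    obtain ⟨f, rfl⟩ := exists_eq_ofFn (h.trans hm)
    obtain ⟨g, rfl⟩ := exists_eq_ofFn hm
    rw [List.map_ofFn, List.map_ofFn, wedgeKernel_ofFn, wedgeKernel_ofFn]
    simp [LinearIsometry.inner_map_map]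
  · rw [wedgeKernel_of_length_ne h, wedgeKernel_of_length_ne (by simpa using h)]

lemma wedgeKernel_map_kerProj (T : H →ₗᵢ[ℂ] H) (v w : List H) :
    wedgeKernel v (w.map (kerProj T)) = wedgeKernel (v.map (kerProj T)) (w.map (kerProj T)) := by
  by_cases h : v.length = w.length
  · obtain ⟨m, hm⟩ : ∃ m, w.length = m := ⟨_, rfl⟩
    obtain ⟨f, rfl⟩ := exists_eq_ofFn (h.trans hm)
    obtain ⟨g, rfl⟩ := exists_eq_ofFn hm
    rw [List.map_ofFn, List.map_ofFn, wedgeKernel_ofFn, wedgeKernel_ofFn]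
    congr 1
    ext i j
    exact inner_kerProj_right T _ _
  · rw [wedgeKernel_of_length_ne (by simpa using h), wedgeKernel_of_length_ne (by simpa using h)]

lemma inner_preProj (T : H →ₗᵢ[ℂ] H) (x y : PreFock H) :
    ⟪x, preProj T y⟫_ℂ = ⟪preProj T x, preProj T y⟫_ℂ := by
  induction x using PreFock.induction with
  | h0 => simp
  | hadd x x' hx hx' => simp only [map_add, inner_add_left, hx, hx']
  | hw c v =>
    simp only [map_smul, inner_smul_left]
    congr 1
    induction y using PreFock.induction with
    | h0 => simp
    | hadd y y' hy hy' => simp only [map_add, inner_add_right, hy, hy']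
    | hw c' w =>
      simp only [map_smul, inner_smul_right, preProj, preFockLift_preWedge, inner_preWedge]
      rw [wedgeKernel_map_kerProj]

lemma norm_preProj_le (T : H →ₗᵢ[ℂ] H) (x : PreFock H) : ‖preProj T x‖ ≤ ‖x‖ := by
  have h1 : ‖preProj T x‖ * ‖preProj T x‖ ≤ ‖x‖ * ‖preProj T x‖ := by
    rw [← inner_self_eq_norm_mul_norm (𝕜 := ℂ), ← inner_preProj]
    exact re_inner_le_norm _ _
  rcases (norm_nonneg (preProj T x)).eq_or_lt with h | h
  · rw [← h]; exact norm_nonneg x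
  · exact le_of_mul_le_mul_right h1 h

lemma inner_preFockMul (T : H →ₗᵢ[ℂ] H) (x x' y y' : PreFock H) :
    ⟪preFockMul T x y, preFockMul T x' y'⟫_ℂ = ⟪preProj T x, preProj T x'⟫_ℂ * ⟪y, y'⟫_ℂ := by
  induction x using PreFock.induction with
  | h0 => simp
  | hadd a b ha hb => simp only [map_add, LinearMap.add_apply, inner_add_left, ha, hb, add_mul]
  | hw c v =>
  simp only [map_smul, LinearMap.smul_apply, inner_smul_left, mul_assoc]
  congr 1
  induction x' using PreFock.induction with
  | h0 => simp
  | hadd a b ha hb => simp only [map_add, LinearMap.add_apply, inner_add_right, ha, hb, add_mul]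
  | hw c' v' =>
  simp only [map_smul, LinearMap.smul_apply, inner_smul_right, mul_assoc]
  congr 1
  induction y using PreFock.induction with
  | h0 => simp
  | hadd a b ha hb => simp only [map_add, inner_add_left, ha, hb, mul_add]
  | hw d w =>
  simp only [map_smul, inner_smul_left, mul_left_comm _ (conj d)]
  congr 1
  induction y' using PreFock.induction with
  | h0 => simp
  | hadd a b ha hb => simp only [map_add, inner_add_right, ha, hb, mul_add]
  | hw d' w' =>
  simp only [map_smul, inner_smul_right, mul_left_comm _ d']
  congr 1
  simp only [preFockMul, preProj, preFockLift_preWedge, inner_preWedge]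
  rw [wedgeKernel_append, wedgeKernel_map_isometry, mul_comm]
  · intro a ha b hb
    obtain ⟨a, -, rfl⟩ := List.mem_map.mp ha
    obtain ⟨b, -, rfl⟩ := List.mem_map.mp hb
    exact inner_isometry_kerProj T _ _
  · intro a ha b hb
    obtain ⟨a, -, rfl⟩ := List.mem_map.mp ha
    obtain ⟨b, -, rfl⟩ := List.mem_map.mp hb
    exact inner_kerProj_isometry T _ _

lemma norm_preFockMul_le (T : H →ₗᵢ[ℂ] H) (x y : PreFock H) :
    ‖preFockMul T x y‖ ≤ 1 * ‖x‖ * ‖y‖ := by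
  have h : ‖preFockMul T x y‖ = ‖preProj T x‖ * ‖y‖ := by
    have h2 : ((‖preFockMul T x y‖ ^ 2 : ℝ) : ℂ) = (((‖preProj T x‖ * ‖y‖) ^ 2 : ℝ) : ℂ) := by
      have := inner_preFockMul T x x y y
      rw [inner_self_eq_norm_sq_to_K, inner_self_eq_norm_sq_to_K, inner_self_eq_norm_sq_to_K] at this
      push_cast
      rw [mul_pow]
      exact this
    have h3 := Complex.ofReal_injective h2
    exact (pow_left_inj₀ (norm_nonneg _) (by positivity) two_ne_zero).mp h3
  rw [h, one_mul]
  exact mul_le_mul_of_nonneg_right (norm_preProj_le T x) (norm_nonneg y)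

/-- The product on formal combinations, with values in the Fock space. -/
def preFockMulL (T : H →ₗᵢ[ℂ] H) : PreFock H →L[ℂ] PreFock H →L[ℂ] Fock H :=
  LinearMap.mkContinuous₂
    ((preFockMul T).compr₂ (UniformSpace.Completion.toComplL (𝕜 := ℂ) (E := PreFock H)).toLinearMap)
    1 fun x y => by
      refine le_trans (le_of_eq ?_) (norm_preFockMul_le T x y)
      exact UniformSpace.Completion.norm_coe (preFockMul T x y)

/-- The continuous bilinear map on the Fock space of `H` with
`(ξ₁ ∧ ⋯ ∧ ξₘ) · (η₁ ∧ ⋯ ∧ ηₙ) = Tη₁ ∧ ⋯ ∧ Tηₙ ∧ ξ₁ ∧ ⋯ ∧ ξₘ` for `ξᵢ` in the kernel of `T*`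
and `ηⱼ` in `H` (see `fockMul_wedge`). It is only used with a left factor in the Fock space of
the kernel of `T*`; other left factors are first projected onto that subspace. -/
def fockMul (T : H →ₗᵢ[ℂ] H) : Fock H →L[ℂ] Fock H →L[ℂ] Fock H :=
  (preFockMulL T).fromCompletion.flip.fromCompletion.flip

lemma fockMul_wedge (T : H →ₗᵢ[ℂ] H) (v w : List H)
    (hv : ∀ x ∈ v, T.toContinuousLinearMap.adjoint x = 0) :
    fockMul T (wedge v) (wedge w) = wedge (w.map T ++ v) := by
  have hmap : v.map (kerProj T) = v :=
    (List.map_congr_left fun x hx => kerProj_of_mem T (hv x hx)).trans (List.map_id v)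
  have h : fockMul T (wedge v) (wedge w) = wedge (w.map T ++ v.map (kerProj T)) := by
    simp only [fockMul, wedge, ContinuousLinearMap.flip_apply,
      ContinuousLinearMap.fromCompletion_apply_coe]
    simp only [preFockMulL, LinearMap.mkContinuous₂_apply, LinearMap.compr₂_apply]
    simp only [preFockMul, preFockLift_preWedge]
    rfl
  rw [h, hmap]

end Fock

section ProductSystem

variable {H : Type*} [NormedAddCommGroup H] [InnerProductSpace ℂ H]

/-- A semigroup of isometries of `H` indexed by an additive monoid `M`. -/
structure IsometrySemigroup (M : Type*) [AddCommMonoid M] (H : Type*) [NormedAddCommGroup H]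
    [InnerProductSpace ℂ H] where
  toFun : M → H →ₗᵢ[ℂ] H
  map_add : ∀ x y v, toFun (x + y) v = toFun x (toFun y v)

variable [CompleteSpace H]

/-- For an isometry `T`, the antisymmetric Fock space of the kernel of `T*`, viewed as a closed
subspace of the Fock space of `H`. For a semigroup of isometries `V`, the fibre over `x` of the
product system of the CAR flow is `E(x) = carFibre (V x)`, and the product of `ξ ∈ E(x)` and
`η ∈ E(y)` is `fockMul (V x) ξ η ∈ E(x + y)`. -/
def carFibre (T : H →ₗᵢ[ℂ] H) : Submodule ℂ (Fock H) :=
  (Submodule.span ℂ {ψ : Fock H | ∃ v : List H,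
    (∀ x ∈ v, T.toContinuousLinearMap.adjoint x = 0) ∧ ψ = wedge v}).topologicalClosure

/-- `u` is a unit of the product system of the CAR flow associated with `V`: a weakly measurable
multiplicative section with no zero. -/
structure IsUnitOf {M : Type*} [AddCommMonoid M] [MeasurableSpace M] (V : IsometrySemigroup M H)
    (u : M → Fock H) : Prop where
  mem_fibre : ∀ x, u x ∈ carFibre (V.toFun x)
  measurable : ∀ ψ : Fock H, Measurable fun x => ⟪ψ, u x⟫_ℂ
  ne_zero : ∀ x, u x ≠ 0
  mul : ∀ x y, fockMul (V.toFun x) (u x) (u y) = u (x + y)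

/-- `b ∈ E(t)` is additive decomposable with respect to the vacuum unit, in the one-parameter
product system of the CAR flow of `W`. -/
def IsAdditiveDecomposable (W : IsometrySemigroup ℝ≥0 H) (t : ℝ≥0) (b : Fock H) : Prop :=
  b ∈ carFibre (W.toFun t) ∧ ⟪vacuum H, b⟫_ℂ = 0 ∧
    ∀ s ≤ t, ∃ b₁ ∈ carFibre (W.toFun s), ∃ b₂ ∈ carFibre (W.toFun (t - s)),
      ⟪vacuum H, b₁⟫_ℂ = 0 ∧ ⟪vacuum H, b₂⟫_ℂ = 0 ∧
      b = fockMul (W.toFun s) b₁ (vacuum H) + fockMul (W.toFun s) (vacuum H) b₂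

/-- `(b_s)`, `0 ≤ s ≤ t`, is a coherent section of additive decomposable vectors with increments
`β r s ∈ E(s - r)`: `b_s = b_r · Ω + Ω · β r s` for `r ≤ s ≤ t`. (The `β r s` are determined by
the `b_s`, and so are the `b_s` by `b_t`. Values outside `[0, t]` play no role.) -/
def IsCoherentSection (W : IsometrySemigroup ℝ≥0 H) (t : ℝ≥0) (b : ℝ≥0 → Fock H)
    (β : ℝ≥0 → ℝ≥0 → Fock H) : Prop :=
  (∀ s ≤ t, IsAdditiveDecomposable W s (b s)) ∧
    ∀ r s, r ≤ s → s ≤ t → β r s ∈ carFibre (W.toFun (s - r)) ∧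
      b s = fockMul (W.toFun r) (b r) (vacuum H) + fockMul (W.toFun r) (vacuum H) (β r s)

/-- The Riemann sum `∑ᵢ x_{rᵢ} · β(rᵢ, rᵢ₊₁) · Ω_{s - rᵢ₊₁}`, with `rᵢ = i s / k` for `0 ≤ i < k`,
of the Itô integral of `x` over `[0, s]`. -/
def itoSum (W : IsometrySemigroup ℝ≥0 H) (β : ℝ≥0 → ℝ≥0 → Fock H) (x : ℝ≥0 → Fock H) (s : ℝ≥0)
    (k : ℕ) : Fock H :=
  ∑ i ∈ Finset.range k,
    fockMul (W.toFun (i * s / k)) (x (i * s / k))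
      (fockMul (W.toFun ((i + 1) * s / k - i * s / k)) (β (i * s / k) ((i + 1) * s / k))
        (vacuum H))

/-- `z` is the exponential of `b ∈ E(t)`: `z = ∑ₙ x⁽ⁿ⁾_t`, where `(b_s)` is the coherent section
with `b_t = b`, `x⁽⁰⁾_s = Ω`, `x⁽¹⁾_s = b_s`, and `x⁽ⁿ⁺¹⁾_s` is the Itô integral of `x⁽ⁿ⁾` over
`[0, s]` for `n ≥ 1`. All of these are uniquely determined by `b`, hence so is `z`. -/
def IsExponential (W : IsometrySemigroup ℝ≥0 H) (t : ℝ≥0) (b z : Fock H) : Prop :=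
  ∃ (bs : ℝ≥0 → Fock H) (β : ℝ≥0 → ℝ≥0 → Fock H) (x : ℕ → ℝ≥0 → Fock H),
    IsCoherentSection W t bs β ∧ bs t = b ∧
    (∀ s ≤ t, x 0 s = vacuum H) ∧ (∀ s ≤ t, x 1 s = bs s) ∧
    (∀ n, 1 ≤ n → ∀ s ≤ t, Tendsto (itoSum W β (x n) s) atTop (𝓝 (x (n + 1) s))) ∧
    HasSum (fun n => x n t) z

open Classical in
/-- The exponential `Exp(b)` of `b ∈ E(t)` in a one-parameter product system of a CAR flow. -/
def oneParamExp (W : IsometrySemigroup ℝ≥0 H) (t : ℝ≥0) (b : Fock H) : Fock H :=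
  if h : ∃ z, IsExponential W t b z then h.choose else 0

/-- The one-parameter semigroup `t ↦ V_{ta}`; its product system is `t ↦ E(ta)`. -/
def ray {d : ℕ} {P : ProperCone ℝ (Euc d)} (V : IsometrySemigroup P H) (a : P) :
    IsometrySemigroup ℝ≥0 H where
  toFun t := V.toFun ⟨(t : ℝ) • (a : Euc d), P.smul_mem a.2 t.2⟩
  map_add s t v := by
    rw [← V.map_add]
    congr 2
    exact Subtype.ext (add_smul (s : ℝ) (t : ℝ) (a : Euc d))

/-- `Exp_a(ξ)` for a one-particle vector `ξ` in the kernel of `V_a*`, regarded as an element of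
`E(a)`: the exponential of `ξ` at time `1` in the product system `t ↦ E(ta)`. -/
def rayExp {d : ℕ} {P : ProperCone ℝ (Euc d)} (V : IsometrySemigroup P H) (a : P) (ξ : H) :
    Fock H :=
  oneParamExp (ray V a) 1 (wedge [ξ])

end ProductSystem

section Yu

/-- The Fell topology on the closed subsets of `X`, generated by the sets `{A | A ∩ K = ∅}` with
`K` compact and `{A | A ∩ U ≠ ∅}` with `U` open. -/
@[reducible]
def fellTopology (X : Type*) [TopologicalSpace X] :
    TopologicalSpace (TopologicalSpace.Closeds X) :=
  TopologicalSpace.generateFrom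
    ({S | ∃ K : Set X, IsCompact K ∧ S = {A : TopologicalSpace.Closeds X | (A : Set X) ∩ K = ∅}} ∪
      {S | ∃ U : Set X, IsOpen U ∧ S = {A : TopologicalSpace.Closeds X | ((A : Set X) ∩ U).Nonempty}})

variable {d : ℕ} (P : ProperCone ℝ (Euc d))

/-- `Y_u`: the closed subsets `A` of `ℝ^d` with `-P + A ⊆ A`, `A ≠ ∅` and `A ≠ ℝ^d`. -/
def Yu : Type :=
  {A : TopologicalSpace.Closeds (Euc d) //
    -(P : Set (Euc d)) + (A : Set (Euc d))
      ⊆ (A : Set (Euc d)) ∧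
    (A : Set (Euc d)) ≠ ∅ ∧
    (A : Set (Euc d)) ≠ Set.univ}

namespace Yu

instance : TopologicalSpace (Yu P) :=
  TopologicalSpace.induced Subtype.val (fellTopology (Euc d))

instance : MeasurableSpace (Yu P) := borel (Yu P)

instance : BorelSpace (Yu P) := ⟨rfl⟩

variable {P}

/-- The subset of `ℝ^d` underlying a point of `Y_u`. -/
def toSet (A : Yu P) : Set (Euc d) := A.1

lemma isClosed_toSet (A : Yu P) : IsClosed A.toSet := A.1.isClosed

lemma ext {A B : Yu P} (h : A.toSet = B.toSet) : A = B :=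
  Subtype.ext (TopologicalSpace.Closeds.ext h)

lemma sub_mem (A : Yu P) {x p : Euc d} (hx : x ∈ A.toSet) (hp : p ∈ P) :
    x - p ∈ A.toSet := by
  rw [sub_eq_neg_add]
  exact A.2.1 (Set.add_mem_add (by simpa using hp) hx)

lemma exists_mem (A : Yu P) : ∃ x, x ∈ A.toSet := Set.nonempty_iff_ne_empty.mpr A.2.2.1

lemma exists_notMem (A : Yu P) : ∃ x, x ∉ A.toSet := (Set.ne_univ_iff_exists_notMem _).mp A.2.2.2

/-- A point of `Y_u` from its defining properties. -/
def mk' (A : Set (Euc d)) (hc : IsClosed A)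
    (hP : ∀ x ∈ A, ∀ p ∈ P, x - p ∈ A) (h1 : ∃ x, x ∈ A) (h2 : ∃ x, x ∉ A) : Yu P :=
  ⟨⟨A, hc⟩, by
    rintro _ ⟨q, hq, x, hx, rfl⟩
    have := hP x hx (-q) hq
    rwa [sub_neg_eq_add, add_comm] at this, Set.nonempty_iff_ne_empty.mp h1,
    (Set.ne_univ_iff_exists_notMem _).mpr h2⟩

lemma toSet_mk' (A : Set (Euc d)) (hc : IsClosed A)
    (hP : ∀ x ∈ A, ∀ p ∈ P, x - p ∈ A) (h1 : ∃ x, x ∈ A) (h2 : ∃ x, x ∉ A) :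
    (mk' A hc hP h1 h2).toSet = A := rfl

/-- The action of `ℝ^d` on `Y_u` by translations, `(x, A) ↦ A + x`. -/
instance : VAdd (Euc d) (Yu P) where
  vadd x A := mk' ((fun y => y - x) ⁻¹' A.toSet) (A.isClosed_toSet.preimage (by fun_prop))
    (fun y hy p hp => by
      have := A.sub_mem hy hp
      rwa [Set.mem_preimage, sub_right_comm])
    (by
      obtain ⟨y, hy⟩ := A.exists_mem
      exact ⟨y + x, by simpa using hy⟩)
    (by
      obtain ⟨y, hy⟩ := A.exists_notMem
      exact ⟨y + x, by simpa using hy⟩)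

lemma mem_vadd {x y : Euc d} {A : Yu P} :
    y ∈ (x +ᵥ A).toSet ↔ y - x ∈ A.toSet := Iff.rfl

lemma vadd_toSet (x : Euc d) (A : Yu P) :
    (x +ᵥ A).toSet = A.toSet + {x} := by
  ext y
  rw [mem_vadd, Set.add_singleton]
  constructor
  · intro h
    exact ⟨y - x, h, by simp⟩
  · rintro ⟨z, hz, rfl⟩
    simpa using hz

lemma vadd_vadd' (x y : Euc d) (A : Yu P) : x +ᵥ (y +ᵥ A) = (x + y) +ᵥ A := by
  refine ext (Set.ext fun z => ?_)
  rw [mem_vadd, mem_vadd, mem_vadd, sub_sub]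

lemma zero_vadd' (A : Yu P) : (0 : Euc d) +ᵥ A = A := by
  refine ext (Set.ext fun z => ?_)
  rw [mem_vadd, sub_zero]

lemma isOpen_miss {K : Set (Euc d)} (hK : IsCompact K) :
    IsOpen {A : Yu P | A.toSet ∩ K = ∅} :=
  ⟨_, TopologicalSpace.isOpen_generateFrom_of_mem (Or.inl ⟨K, hK, rfl⟩), rfl⟩

lemma isOpen_hit {U : Set (Euc d)} (hU : IsOpen U) :
    IsOpen {A : Yu P | (A.toSet ∩ U).Nonempty} :=
  ⟨_, TopologicalSpace.isOpen_generateFrom_of_mem (Or.inr ⟨U, hU, rfl⟩), rfl⟩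

lemma topology_eq : (inferInstance : TopologicalSpace (Yu P)) = TopologicalSpace.generateFrom
    ({S | ∃ K : Set (Euc d), IsCompact K ∧ S = {A | A.toSet ∩ K = ∅}} ∪
      {S | ∃ U : Set (Euc d), IsOpen U ∧ S = {A | (A.toSet ∩ U).Nonempty}}) := by
  refine le_antisymm ?_ ?_
  · refine le_generateFrom ?_
    rintro S (⟨K, hK, rfl⟩ | ⟨U, hU, rfl⟩)
    · exact isOpen_miss hK
    · exact isOpen_hit hU
  · change _ ≤ TopologicalSpace.induced Subtype.val (fellTopology _)
    unfold fellTopology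
    rw [induced_generateFrom_eq]
    refine le_generateFrom ?_
    rintro _ ⟨S, (⟨K, hK, rfl⟩ | ⟨U, hU, rfl⟩), rfl⟩
    · exact TopologicalSpace.isOpen_generateFrom_of_mem (Or.inl ⟨K, hK, rfl⟩)
    · exact TopologicalSpace.isOpen_generateFrom_of_mem (Or.inr ⟨U, hU, rfl⟩)

lemma continuous_vadd' (x : Euc d) : Continuous fun A : Yu P => x +ᵥ A := by
  have h := continuous_generateFrom_iff (t := (inferInstance : TopologicalSpace (Yu P)))
    (f := fun A : Yu P => x +ᵥ A)
    (b := {S | ∃ K : Set (Euc d), IsCompact K ∧ S = {A | A.toSet ∩ K = ∅}} ∪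
      {S | ∃ U : Set (Euc d), IsOpen U ∧ S = {A | (A.toSet ∩ U).Nonempty}})
  rw [← topology_eq] at h
  refine h.mpr ?_
  have hshift : ∀ (A : Yu P) (S : Set (Euc d)),
      ((x +ᵥ A).toSet ∩ S).Nonempty ↔ (A.toSet ∩ ((fun y => y + x) ⁻¹' S)).Nonempty := by
    intro A S
    constructor
    · rintro ⟨y, hy, hS⟩
      exact ⟨y - x, hy, by simpa using hS⟩
    · rintro ⟨y, hy, hS⟩
      exact ⟨y + x, by simpa [mem_vadd] using hy, hS⟩
  rintro S (⟨K, hK, rfl⟩ | ⟨U, hU, rfl⟩)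
  · have : (fun A : Yu P => x +ᵥ A) ⁻¹' {A | A.toSet ∩ K = ∅}
        = {A | A.toSet ∩ ((fun y => y + x) ⁻¹' K) = ∅} := by
      ext A
      simp only [Set.mem_preimage, Set.mem_ofPred_eq, ← Set.not_nonempty_iff_eq_empty, hshift]
    rw [this]
    exact isOpen_miss ((Homeomorph.addRight x).isCompact_preimage.mpr hK)
  · have : (fun A : Yu P => x +ᵥ A) ⁻¹' {A | (A.toSet ∩ U).Nonempty}
        = {A | (A.toSet ∩ ((fun y => y + x) ⁻¹' U)).Nonempty} := by
      ext A
      simp only [Set.mem_preimage, Set.mem_ofPred_eq, hshift]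
    rw [this]
    exact isOpen_hit (hU.preimage (by fun_prop))

instance : MeasurableConstVAdd (Euc d) (Yu P) where
  measurable_const_vadd x := (continuous_vadd' x).measurable

variable (P) in
/-- `X_u = {A ∈ Y_u | 0 ∈ A}`. -/
def Xu : Set (Yu P) := {A | (0 : Euc d) ∈ A.toSet}

variable (P) in
/-- The translate `X_u + a`. -/
def XuAdd (a : Euc d) : Set (Yu P) := (fun A => a +ᵥ A) '' Xu P

lemma mem_XuAdd {a : Euc d} {A : Yu P} :
    A ∈ XuAdd P a ↔ (-a) +ᵥ A ∈ Xu P := by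
  constructor
  · rintro ⟨B, hB, rfl⟩
    dsimp only
    rwa [vadd_vadd', neg_add_cancel, zero_vadd']
  · intro h
    exact ⟨_, h, by dsimp only; rw [vadd_vadd', add_neg_cancel, zero_vadd']⟩

lemma mem_XuAdd_iff {a : Euc d} {A : Yu P} : A ∈ XuAdd P a ↔ a ∈ A.toSet := by
  rw [mem_XuAdd, Xu, Set.mem_ofPred_eq, mem_vadd]
  simp

lemma isClosed_Xu : IsClosed (Xu P) := by
  rw [← isOpen_compl_iff]
  convert isOpen_miss (P := P) (isCompact_singleton (x := (0 : Euc d))) using 1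
  ext A
  simp [Xu, Set.inter_singleton_eq_empty]

lemma measurableSet_Xu : MeasurableSet (Xu P) := isClosed_Xu.measurableSet

lemma XuAdd_eq_preimage (a : Euc d) :
    XuAdd P a = (fun A => (-a) +ᵥ A) ⁻¹' Xu P := Set.ext fun _ => mem_XuAdd

lemma measurableSet_XuAdd (a : Euc d) : MeasurableSet (XuAdd P a) := by
  rw [XuAdd_eq_preimage]
  exact measurableSet_Xu.preimage (measurable_const_vadd (-a))

lemma XuAdd_subset (a : P) : XuAdd P (a : Euc d) ⊆ Xu P := by
  intro A hA
  rw [mem_XuAdd_iff] at hA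
  have := A.sub_mem hA a.2
  rwa [sub_self] at this

lemma interior_nonempty (hP : (P : Set (Euc d)) - (P : Set (Euc d)) = Set.univ) :
    (interior (P : Set (Euc d))).Nonempty := by
  have hconv : Convex ℝ (P : Set (Euc d)) := by
    intro x hx y hy a b ha hb _
    exact add_mem (P.smul_mem hx ha) (P.smul_mem hy hb)
  rw [hconv.interior_nonempty_iff_affineSpan_eq_top, eq_top_iff]
  intro x _
  obtain ⟨p, hp, q, hq, rfl⟩ : x ∈ (P : Set (Euc d)) - (P : Set (Euc d)) := hP ▸ Set.mem_univ x
  have := (affineSpan ℝ (P : Set (Euc d))).smul_vsub_vadd_mem (1 : ℝ) (subset_affineSpan ℝ _ hp)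
    (subset_affineSpan ℝ _ hq) (subset_affineSpan ℝ _ (P.zero_mem : (0 : Euc d) ∈ P))
  simpa using this

lemma isCompact_aux {U : Set (Euc d)} (hU : IsOpen U) (hne : U.Nonempty) :
    IsCompact {A : Yu P | (0 : Euc d) ∈ A.toSet ∧ A.toSet ∩ U = ∅} := by
  rw [isCompact_iff_ultrafilter_le_nhds]
  intro F hF
  have hF' : ∀ᶠ B in (F : Filter (Yu P)), (0 : Euc d) ∈ B.toSet ∧ B.toSet ∩ U = ∅ :=
    hF (mem_principal_self _)
  let L : Set (Euc d) := {x | ∀ V : Set (Euc d), IsOpen V → x ∈ V →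
    ∀ᶠ B in (F : Filter (Yu P)), (B.toSet ∩ V).Nonempty}
  have hLU : L ∩ U = ∅ := by
    rw [Set.eq_empty_iff_forall_notMem]
    rintro x ⟨hx, hxU⟩
    obtain ⟨B, hB1, hB2⟩ := ((hx U hU hxU).and hF').exists
    rw [hB2.2] at hB1
    exact Set.not_nonempty_empty hB1
  have hL0 : (0 : Euc d) ∈ L := fun V _ h0 => hF'.mono fun B hB => ⟨0, hB.1, h0⟩
  have hLc : IsClosed L := by
    rw [← isOpen_compl_iff, isOpen_iff_forall_mem_open]
    intro x hx
    simp only [L, Set.mem_compl_iff, Set.mem_ofPred_eq, not_forall] at hx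
    obtain ⟨V, hV, hxV, hn⟩ := hx
    exact ⟨V, fun y hy hyL => hn (hyL V hV hy), hV, hxV⟩
  have hLP : ∀ x ∈ L, ∀ p ∈ P, x - p ∈ L := by
    intro x hx p hp V hV hxV
    refine (hx ((fun y => y - p) ⁻¹' V) (hV.preimage (by fun_prop)) hxV).mono ?_
    rintro B ⟨y, hy, hyV⟩
    exact ⟨y - p, B.sub_mem hy hp, hyV⟩
  have hL2 : ∃ x, x ∉ L := by
    obtain ⟨x, hx⟩ := hne
    exact ⟨x, fun h => by
      have : x ∈ L ∩ U := ⟨h, hx⟩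
      rw [hLU] at this
      exact this⟩
  refine ⟨mk' L hLc hLP ⟨0, hL0⟩ hL2, ⟨hL0, hLU⟩, ?_⟩
  have hn : 𝓝 (mk' L hLc hLP ⟨0, hL0⟩ hL2) = _ :=
    (congrArg (fun t => @nhds (Yu P) t (mk' L hLc hLP ⟨0, hL0⟩ hL2)) topology_eq).trans
      TopologicalSpace.nhds_generateFrom
  rw [hn]
  refine le_iInf₂ fun S hS => ?_
  rw [le_principal_iff]
  obtain ⟨hLS, ⟨K, hK, rfl⟩ | ⟨V, hV, rfl⟩⟩ := hS
  · have hLK : L ∩ K = ∅ := hLS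
    change ∀ᶠ B in (F : Filter (Yu P)), B.toSet ∩ K = ∅
    refine hK.induction_on (p := fun s => ∀ᶠ B in (F : Filter (Yu P)), B.toSet ∩ s = ∅) ?_ ?_ ?_ ?_
    · simp
    · intro s t hst ht
      refine ht.mono fun B hB => ?_
      exact Set.subset_eq_empty (Set.inter_subset_inter_right _ hst) hB
    · intro s t hs ht
      filter_upwards [hs, ht] with B h1 h2
      rw [Set.inter_union_distrib_left, h1, h2, Set.union_empty]
    · intro x hx
      have hxL : x ∉ L := fun h => by
        have : x ∈ L ∩ K := ⟨h, hx⟩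
        rw [hLK] at this
        exact this
      simp only [L, Set.mem_ofPred_eq, not_forall] at hxL
      obtain ⟨V, hV, hxV, hnV⟩ := hxL
      refine ⟨V, mem_nhdsWithin_of_mem_nhds (hV.mem_nhds hxV), ?_⟩
      rw [← Ultrafilter.eventually_not] at hnV
      exact hnV.mono fun B hB => Set.not_nonempty_iff_eq_empty.mp hB
  · obtain ⟨x, hxL, hxV⟩ : (L ∩ V).Nonempty := hLS
    exact hxL V hV hxV

/-- `X_u \ (X_u + a)` has finite measure, because it is contained in a compact set. -/
lemma measure_diff_lt_top (hP : (P : Set (Euc d)) - (P : Set (Euc d)) = Set.univ)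
    (μ : Measure (Yu P)) [IsFiniteMeasureOnCompacts μ] (a : Euc d) :
    μ (Xu P \ XuAdd P a) < ⊤ := by
  obtain ⟨v, hv⟩ := interior_nonempty hP
  let U : Set (Euc d) := (fun y => y - a) ⁻¹' interior (P : Set (Euc d))
  have hU : IsOpen U := isOpen_interior.preimage (by fun_prop)
  have hne : U.Nonempty := ⟨v + a, by simpa [U] using hv⟩
  refine lt_of_le_of_lt (measure_mono ?_) (isCompact_aux hU hne).measure_lt_top
  rintro A ⟨h0, ha⟩
  refine ⟨h0, ?_⟩
  rw [Set.eq_empty_iff_forall_notMem]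
  rintro y ⟨hy, hyU⟩
  refine ha (mem_XuAdd_iff.mpr ?_)
  have := A.sub_mem hy (interior_subset hyU)
  rwa [sub_sub_cancel] at this

variable (μ : Measure (Yu P)) [VAddInvariantMeasure (Euc d) (Yu P) μ]

open Classical in
/-- The function `A ↦ f (A - a)` if `A - a ∈ X_u`, and `A ↦ 0` otherwise. -/
def shiftFun (a : Euc d) (f : Yu P → ℂ) : Yu P → ℂ :=
  fun A => if (-a) +ᵥ A ∈ Xu P then f ((-a) +ᵥ A) else 0

lemma shiftFun_eq (a : Euc d) (f : Yu P → ℂ) :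
    shiftFun a f = (XuAdd P a).indicator (f ∘ fun A => (-a) +ᵥ A) := by
  classical
  ext A
  rw [shiftFun, Set.indicator_apply]
  simp only [mem_XuAdd, Function.comp_apply]

lemma shiftFun_shiftFun (a b : P) (f : Yu P → ℂ) :
    shiftFun (a : Euc d) (shiftFun (b : Euc d) f) = shiftFun ((a + b : P) : Euc d) f := by
  classical
  ext A
  have e : (-(b : Euc d)) +ᵥ ((-(a : Euc d)) +ᵥ A) = (-((a + b : P) : Euc d)) +ᵥ A := by
    rw [vadd_vadd']
    congr 1
    push_cast
    abel
  simp only [shiftFun]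
  rw [e]
  by_cases h : (-((a + b : P) : Euc d)) +ᵥ A ∈ Xu P
  · have h1 : (-(a : Euc d)) +ᵥ A ∈ Xu P := by
      rw [← e, ← mem_XuAdd] at h
      exact XuAdd_subset b h
    rw [if_pos h1]
  · rw [if_neg h, ite_self]

lemma measurePreserving_shift (a : P) :
    MeasurePreserving (fun A : Yu P => (-(a : Euc d)) +ᵥ A)
      ((μ.restrict (Xu P)).restrict (XuAdd P (a : Euc d))) (μ.restrict (Xu P)) := by
  rw [Measure.restrict_restrict (measurableSet_XuAdd _),
    Set.inter_eq_left.mpr (XuAdd_subset a), XuAdd_eq_preimage]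
  exact (measurePreserving_vadd (-(a : Euc d)) μ).restrict_preimage measurableSet_Xu

lemma eLpNorm_shiftFun (a : P) {f : Yu P → ℂ} (hf : AEStronglyMeasurable f (μ.restrict (Xu P))) :
    eLpNorm (shiftFun (a : Euc d) f) 2 (μ.restrict (Xu P)) = eLpNorm f 2 (μ.restrict (Xu P)) := by
  rw [shiftFun_eq, eLpNorm_indicator_eq_eLpNorm_restrict (measurableSet_XuAdd _),
    eLpNorm_comp_measurePreserving hf (measurePreserving_shift μ a)]

lemma memLp_shiftFun (a : P) {f : Yu P → ℂ} (hf : MemLp f 2 (μ.restrict (Xu P))) :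
    MemLp (shiftFun (a : Euc d) f) 2 (μ.restrict (Xu P)) := by
  rw [shiftFun_eq, memLp_indicator_iff_restrict (measurableSet_XuAdd _)]
  exact hf.comp_measurePreserving (measurePreserving_shift μ a)

lemma shiftFun_congr (a : P) {f g : Yu P → ℂ} (h : f =ᵐ[μ.restrict (Xu P)] g) :
    shiftFun (a : Euc d) f =ᵐ[μ.restrict (Xu P)] shiftFun (a : Euc d) g := by
  rw [shiftFun_eq, shiftFun_eq, ← ae_eq_restrict_iff_indicator_ae_eq (measurableSet_XuAdd _)]
  exact (measurePreserving_shift μ a).quasiMeasurePreserving.ae_eq_comp h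

/-- The isometry `V_a^μ` of `L²(X_u, μ)`: `(V_a f)(A) = f (A - a)` if `A - a ∈ X_u`, and `0`
otherwise. -/
def shiftIsometry (a : P) : Lp ℂ 2 (μ.restrict (Xu P)) →ₗᵢ[ℂ] Lp ℂ 2 (μ.restrict (Xu P)) where
  toFun f := (memLp_shiftFun μ a (Lp.memLp f)).toLp _
  map_add' f g := by
    rw [← MemLp.toLp_add, MemLp.toLp_eq_toLp_iff]
    refine (shiftFun_congr μ a (Lp.coeFn_add f g)).trans (ae_of_all _ fun A => ?_)
    simp only [shiftFun, Pi.add_apply]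
    split_ifs <;> simp
  map_smul' c f := by
    rw [RingHom.id_apply, ← MemLp.toLp_const_smul, MemLp.toLp_eq_toLp_iff]
    refine (shiftFun_congr μ a (Lp.coeFn_smul c f)).trans (ae_of_all _ fun A => ?_)
    simp only [shiftFun, Pi.smul_apply]
    split_ifs <;> simp
  norm_map' f := by
    change ‖(memLp_shiftFun μ a (Lp.memLp f)).toLp _‖ = ‖f‖
    rw [Lp.norm_toLp, Lp.norm_def, eLpNorm_shiftFun μ a (Lp.aestronglyMeasurable f)]

lemma coeFn_shiftIsometry (a : P) (f : Lp ℂ 2 (μ.restrict (Xu P))) :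
    shiftIsometry μ a f =ᵐ[μ.restrict (Xu P)] shiftFun (a : Euc d) f :=
  MemLp.coeFn_toLp (memLp_shiftFun μ a (Lp.memLp f))

lemma shiftIsometry_add (a b : P) (f : Lp ℂ 2 (μ.restrict (Xu P))) :
    shiftIsometry μ (a + b) f = shiftIsometry μ a (shiftIsometry μ b f) := by
  refine Lp.ext ((coeFn_shiftIsometry μ (a + b) f).trans ?_)
  rw [← shiftFun_shiftFun]
  exact ((coeFn_shiftIsometry μ a _).trans
    (shiftFun_congr μ a (coeFn_shiftIsometry μ b f))).symm

/-- The vector `1_{X_u \ (X_u + a)}` of `L²(X_u, μ)`. -/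
def cocycle (hP : (P : Set (Euc d)) - (P : Set (Euc d)) = Set.univ)
    (μ : Measure (Yu P)) [IsFiniteMeasureOnCompacts μ] (a : P) : Lp ℂ 2 (μ.restrict (Xu P)) :=
  indicatorConstLp 2 (s := Xu P \ XuAdd P (a : Euc d))
    (measurableSet_Xu.diff (measurableSet_XuAdd _))
    ((Measure.restrict_apply_le _ _).trans_lt (measure_diff_lt_top hP μ _)).ne (1 : ℂ)

/-- The semigroup of isometries `V^μ` of `P` on `L²(X_u, μ)`. -/
def shiftSemigroup : IsometrySemigroup P (Lp ℂ 2 (μ.restrict (Xu P))) where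
  toFun := shiftIsometry μ
  map_add := shiftIsometry_add μ

variable (P) in
/-- `Y_u^λ`: the translates of the half-space `H^λ = {x | ⟪λ, x⟫ ≤ 0}`. -/
def halfSpaces (lam : Euc d) : Set (Yu P) :=
  {A | ∃ t : ℝ, A.toSet = {x : Euc d | ⟪lam, x⟫_ℝ ≤ 0} + {t • lam}}


variable (P) in
/-- `S(P*)`: the unit vectors of the dual cone of `P`. -/
def dualSphere : Set (Euc d) := {lam | (∀ x ∈ P, 0 ≤ ⟪lam, x⟫_ℝ) ∧ ‖lam‖ = 1}

end Yu

end Yu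

end CARFlow

end

open CARFlow

/-!
The isometry `V_a` cuts `X_u` into the range part `X_u + a` and the kernel part `X_u \ (X_u + a)`,
and the product of the CAR flow is the tensor product of the corresponding Fock spaces. Everything
about the Fock space is checked on wedge products and extended by density: the product is graded
(`numProj_fockMul`), associative (`fockMul_assoc`) and multiplies inner products (`inner_fockMul`).

*A unit forces half-spaces.* Only the one-particle component of `Exp_a(1_{X_u \ (X_u + a)})` is
needed, and it is the indicator function itself (`IsExponential.numProj_one`). For `a, b ∈ P` let
`f` and `g` be the indicator functions of `(X_u + a) \ (X_u + b)` and `(X_u + b) \ (X_u + a)`. Then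
`f` lies in the range of `V_a` and `g` in the kernel of `V_a*`, so `f ∧ g` factorises in
`E(a) · E(b)` and its inner product with the unit at `a + b` is `‖f‖² ‖g‖²`. Exchanging `a` and `b`,
that of `g ∧ f` is the same number; since `f ∧ g = - g ∧ f`, one of the two sets is null
(`measure_diff_eq_zero_of_isUnitOf`). As every set in `Y_u` is the closure of its interior, two
points of the support which are not comparable for inclusion would have neighbourhoods, of positive
measure, which after a common translation lie in these two sets. So the support is totally ordered
by inclusion (`support_total`). If `A` is comparable with all its translates, then
`{x | A - x ⊆ A}` is a closed convex cone whose union with its negative is everything, hence a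
half-space, and so is `A`. Comparing any other `B` in the support with the translates of `A` gives
the same normal vector (`exists_support_eq_halfSpaces`).

*Half-spaces give a unit.* If `μ` lives on the translates of `H^λ`, then `V_a` and the cocycle
depend on `⟪λ, a⟫` only, so everything happens in one one-parameter semigroup with a cocycle `η` of
orthogonal increments and `‖η_s‖² = c s`. To a partition of `[0, s]` with steps `hᵢ` belongs the
product of the vectors `Ω + η_{hᵢ}`. The change under refinement is orthogonal to this product, whose
squared norm `∏ (1 + c hᵢ)` is at most `exp (c s)`; so the products converge, and common
refinements show that the limits `E_s` are multiplicative (`productExp_add`). The `(n + 1)`-particle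
component of `E` is the Itô integral of the `n`-particle component against `dη`, because the errors
of the Riemann sums are pairwise orthogonal and of squared norm `O(h²)` for steps of length `h`
(`tendsto_itoSum`). Hence `E` is the exponential, which is unique (`IsExponential.unique`).
-/

noncomputable section

namespace CARFlow

section FockSpace

variable {H : Type*} [NormedAddCommGroup H] [InnerProductSpace ℂ H]

/-! ### The antisymmetric Fock space and its grading -/

lemma Fock.induction {p : Fock H → Prop} (z : Fock H) (hc : IsClosed {x | p x})
    (h0 : p 0) (hadd : ∀ x y, p x → p y → p (x + y)) (hsmul : ∀ (c : ℂ) x, p x → p (c • x))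
    (hw : ∀ v : List H, p (wedge v)) : p z := by
  induction z using UniformSpace.Completion.induction_on with
  | hp => exact hc
  | ih a =>
    induction a using PreFock.induction with
    | h0 => rw [UniformSpace.Completion.coe_zero]; exact h0
    | hadd x y hx hy => rw [UniformSpace.Completion.coe_add]; exact hadd _ _ hx hy
    | hw c v => rw [UniformSpace.Completion.coe_smul]; exact hsmul c _ (hw v)

/-- Formal linear combinations of wedge products, restricted to the terms of degree `n`. -/
def preNumProj (n : ℕ) : PreFock H →ₗ[ℂ] PreFock H :=
  preFockLift fun v => if v.length = n then preWedge v else 0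

lemma preNumProj_preWedge (n : ℕ) (v : List H) :
    preNumProj n (preWedge v) = if v.length = n then preWedge v else 0 :=
  preFockLift_preWedge _ _

lemma inner_preNumProj (n : ℕ) (x y : PreFock H) :
    ⟪x, preNumProj n y⟫_ℂ = ⟪preNumProj n x, preNumProj n y⟫_ℂ := by
  induction x using PreFock.induction with
  | h0 => simp
  | hadd x x' hx hx' => simp only [map_add, inner_add_left, hx, hx']
  | hw c v =>
    simp only [map_smul, inner_smul_left]
    congr 1
    induction y using PreFock.induction with
    | h0 => simp
    | hadd y y' hy hy' => simp only [map_add, inner_add_right, hy, hy']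
    | hw c' w =>
      simp only [map_smul, inner_smul_right, preNumProj_preWedge]
      split_ifs with h1 h2 h2
      · rfl
      · rw [inner_preWedge, inner_zero_left, wedgeKernel_of_length_ne (by rw [h1]; exact h2)]
      · simp
      · simp

lemma norm_preNumProj_le (n : ℕ) (x : PreFock H) : ‖preNumProj n x‖ ≤ 1 * ‖x‖ := by
  have h1 : ‖preNumProj n x‖ * ‖preNumProj n x‖ ≤ ‖x‖ * ‖preNumProj n x‖ := by
    rw [← inner_self_eq_norm_mul_norm (𝕜 := ℂ), ← inner_preNumProj]
    exact re_inner_le_norm _ _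
  rw [one_mul]
  rcases (norm_nonneg (preNumProj n x)).eq_or_lt with h | h
  · rw [← h]; exact norm_nonneg x
  · exact le_of_mul_le_mul_right h1 h

/-- The degree `n` part of a formal combination, as a vector of the Fock space. -/
def preNumProjL (n : ℕ) : PreFock H →L[ℂ] Fock H :=
  LinearMap.mkContinuous
    ((UniformSpace.Completion.toComplL (𝕜 := ℂ) (E := PreFock H)).toLinearMap ∘ₗ preNumProj n)
    1 fun x => by
      refine le_trans (le_of_eq ?_) (norm_preNumProj_le n x)
      exact UniformSpace.Completion.norm_coe (preNumProj n x)

/-- The orthogonal projection of the Fock space onto its `n`-particle subspace. -/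
def numProj (n : ℕ) : Fock H →L[ℂ] Fock H :=
  (preNumProjL n).fromCompletion

lemma numProj_wedge (n : ℕ) (v : List H) :
    numProj n (wedge v) = if v.length = n then wedge v else 0 := by
  have h : numProj n (wedge v) = ((preNumProj n (preWedge v) : PreFock H) : Fock H) := by
    simp only [numProj, wedge, ContinuousLinearMap.fromCompletion_apply_coe]
    rfl
  rw [h, preNumProj_preWedge]
  split_ifs
  · rfl
  · exact UniformSpace.Completion.coe_zero

lemma numProj_numProj (n : ℕ) (x : Fock H) : numProj n (numProj n x) = numProj n x := by
  induction x using Fock.induction with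
  | hc => exact isClosed_eq (by fun_prop) (by fun_prop)
  | h0 => simp
  | hadd x y hx hy => simp only [map_add, hx, hy]
  | hsmul c x hx => simp only [map_smul, hx]
  | hw v => simp only [numProj_wedge]; split_ifs <;> simp [numProj_wedge, *]

lemma inner_numProj_left (n : ℕ) (x y : Fock H) : ⟪numProj n x, y⟫_ℂ = ⟪x, numProj n y⟫_ℂ := by
  induction x using Fock.induction with
  | hc => exact isClosed_eq (by fun_prop) (by fun_prop)
  | h0 => simp
  | hadd x y hx hy => simp only [map_add, inner_add_left, hx, hy]
  | hsmul c x hx => simp only [map_smul, inner_smul_left, hx]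
  | hw v =>
    induction y using Fock.induction with
    | hc => exact isClosed_eq (by fun_prop) (by fun_prop)
    | h0 => simp
    | hadd x y hx hy => simp only [map_add, inner_add_right, hx, hy]
    | hsmul c x hx => simp only [map_smul, inner_smul_right, hx]
    | hw w =>
      simp only [numProj_wedge]
      split_ifs with h1 h2 h2
      · rfl
      · rw [inner_wedge, inner_zero_right, wedgeKernel_of_length_ne (by rw [h1]; exact Ne.symm h2)]
      · rw [inner_wedge, inner_zero_left, wedgeKernel_of_length_ne (by rw [h2]; exact h1)]
      · simp

lemma numProj_numProj_of_ne {n m : ℕ} (h : n ≠ m) (x : Fock H) :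
    numProj n (numProj m x) = 0 := by
  induction x using Fock.induction with
  | hc => exact isClosed_eq (by fun_prop) (by fun_prop)
  | h0 => simp
  | hadd x y hx hy => simp only [map_add, hx, hy, add_zero]
  | hsmul c x hx => simp only [map_smul, hx, smul_zero]
  | hw v =>
    simp only [numProj_wedge]
    split_ifs with h1
    · rw [numProj_wedge, if_neg (by rw [h1]; exact Ne.symm h)]
    · simp

lemma norm_numProj_le (n : ℕ) (x : Fock H) : ‖numProj n x‖ ≤ ‖x‖ := by
  have h1 : ‖numProj n x‖ * ‖numProj n x‖ ≤ ‖x‖ * ‖numProj n x‖ := by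
    rw [← inner_self_eq_norm_mul_norm (𝕜 := ℂ), inner_numProj_left, numProj_numProj]
    exact re_inner_le_norm _ _
  rcases (norm_nonneg (numProj n x)).eq_or_lt with h | h
  · rw [← h]; exact norm_nonneg x
  · exact le_of_mul_le_mul_right h1 h

lemma norm_sum_numProj_le (s : Finset ℕ) (x : Fock H) : ‖∑ n ∈ s, numProj n x‖ ≤ ‖x‖ := by
  classical
  set q := ∑ n ∈ s, numProj n x with hq
  have h0 : ⟪q, q⟫_ℂ = ⟪x, q⟫_ℂ := by
    conv_lhs => rw [hq, sum_inner]
    conv_rhs => rw [hq, inner_sum]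
    refine Finset.sum_congr rfl fun n hn => ?_
    rw [inner_numProj_left, map_sum]
    rw [Finset.sum_eq_single_of_mem n hn fun m _ hm => numProj_numProj_of_ne (Ne.symm hm) x,
      numProj_numProj]
  have h1 : ‖q‖ * ‖q‖ ≤ ‖x‖ * ‖q‖ := by
    rw [← inner_self_eq_norm_mul_norm (𝕜 := ℂ), h0]
    exact re_inner_le_norm _ _
  rcases (norm_nonneg q).eq_or_lt with h | h
  · rw [← h]; exact norm_nonneg x
  · exact le_of_mul_le_mul_right h1 h

/-- Every vector of the Fock space is the sum of its `n`-particle components. -/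
lemma hasSum_numProj (x : Fock H) : HasSum (fun n => numProj n x) x := by
  induction x using Fock.induction with
  | hc =>
    rw [← isSeqClosed_iff_isClosed]
    intro u x hu hx
    rw [Set.mem_ofPred_eq, HasSum, Metric.tendsto_nhds]
    intro ε hε
    obtain ⟨N, hN⟩ := ((Metric.tendsto_nhds.mp hx (ε / 3) (by positivity))).exists
    have h1 := Metric.tendsto_nhds.mp (hu N) (ε / 3) (by positivity)
    filter_upwards [h1] with s hs
    have h2 := norm_sum_numProj_le s (x - u N)
    simp only [map_sub, Finset.sum_sub_distrib] at h2
    rw [dist_eq_norm] at hN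
    rw [dist_eq_norm] at hs ⊢
    calc _ = ‖(∑ n ∈ s, numProj n x - ∑ n ∈ s, numProj n (u N))
          + (∑ n ∈ s, numProj n (u N) - u N) + (u N - x)‖ := by congr 1; abel
      _ ≤ _ := norm_add₃_le
      _ < ε := by
        rw [norm_sub_rev x] at h2
        linarith
  | h0 => simp
  | hadd x y hx hy => simpa using hx.add hy
  | hsmul c x hx => simpa using hx.const_smul c
  | hw v => simpa only [numProj_wedge, eq_comm] using hasSum_ite_eq v.length (wedge v)

lemma numProj_vacuum (n : ℕ) : numProj n (vacuum H) = if n = 0 then vacuum H else 0 := by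
  rw [vacuum, numProj_wedge]
  simp [eq_comm]

lemma norm_vacuum : ‖vacuum H‖ = 1 := by
  have h : ⟪vacuum H, vacuum H⟫_ℂ = 1 := by
    rw [vacuum, inner_wedge, show ([] : List H) = List.ofFn (fun i : Fin 0 => i.elim0) by simp,
      wedgeKernel_ofFn]
    simp
  rw [@norm_eq_sqrt_re_inner ℂ, h]
  simp

lemma inner_vacuum_self : ⟪vacuum H, vacuum H⟫_ℂ = 1 := by
  rw [inner_self_eq_norm_sq_to_K, norm_vacuum]
  simp

lemma numProj_zero (x : Fock H) : numProj 0 x = ⟪vacuum H, x⟫_ℂ • vacuum H := by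
  induction x using Fock.induction with
  | hc => exact isClosed_eq (by fun_prop) (by fun_prop)
  | h0 => simp
  | hadd x y hx hy => simp only [map_add, inner_add_right, hx, hy, add_smul]
  | hsmul c x hx => simp only [map_smul, inner_smul_right, hx, smul_smul]
  | hw v =>
    rw [numProj_wedge]
    cases v with
    | nil =>
      rw [if_pos List.length_nil]
      change vacuum H = ⟪vacuum H, vacuum H⟫_ℂ • _
      rw [inner_vacuum_self, one_smul]
    | cons a l =>
      rw [if_neg (by simp), vacuum, inner_wedge, wedgeKernel_of_length_ne (by simp), zero_smul]

lemma inner_wedge_singleton (f g : H) : ⟪wedge [f], wedge [g]⟫_ℂ = ⟪f, g⟫_ℂ := by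
  have e : ∀ h : H, [h] = List.ofFn (fun _ : Fin 1 => h) := fun h => by simp
  rw [inner_wedge, e f, e g, wedgeKernel_ofFn, Matrix.det_fin_one]
  rfl

lemma wedge_add (f g : H) : wedge [f + g] = wedge [f] + wedge [g] := by
  have key : ∀ x : Fock H, ⟪x, wedge [f + g]⟫_ℂ = ⟪x, wedge [f] + wedge [g]⟫_ℂ := by
    intro x
    induction x using Fock.induction with
    | hc => exact isClosed_eq (by fun_prop) (by fun_prop)
    | h0 => simp
    | hadd x y hx hy => simp only [inner_add_left, hx, hy]
    | hsmul c x hx => simp only [inner_smul_left, hx]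
    | hw v =>
      rw [inner_add_right]
      by_cases h : v.length = 1
      · obtain ⟨a, rfl⟩ := List.length_eq_one_iff.mp h
        simp only [inner_wedge_singleton, inner_add_right]
      · simp only [inner_wedge]
        rw [wedgeKernel_of_length_ne (by simpa), wedgeKernel_of_length_ne (by simpa),
          wedgeKernel_of_length_ne (by simpa), add_zero]
  exact ext_inner_left ℂ key

lemma wedge_singleton_zero : wedge [(0 : H)] = 0 := by
  simpa using wedge_add (0 : H) 0

lemma wedge_pair_swap (f g : H) : wedge [f, g] = -wedge [g, f] := by
  have key : ∀ x : Fock H, ⟪x, wedge [f, g]⟫_ℂ = ⟪x, -wedge [g, f]⟫_ℂ := by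
    intro x
    induction x using Fock.induction with
    | hc => exact isClosed_eq (by fun_prop) (by fun_prop)
    | h0 => simp
    | hadd x y hx hy => simp only [inner_add_left, hx, hy]
    | hsmul c x hx => simp only [inner_smul_left, hx]
    | hw v =>
      rw [inner_neg_right]
      by_cases h : v.length = 2
      · obtain ⟨a, b, rfl⟩ := List.length_eq_two.mp h
        have e : ∀ h k : H, [h, k] = List.ofFn ![h, k] := fun h k => by simp
        simp only [inner_wedge]
        rw [e a b, e f g, e g f, wedgeKernel_ofFn, wedgeKernel_ofFn]
        simp only [Matrix.det_fin_two, Matrix.of_apply, Matrix.cons_val_zero, Matrix.cons_val_one]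
        ring
      · simp only [inner_wedge]
        rw [wedgeKernel_of_length_ne (by simpa), wedgeKernel_of_length_ne (by simpa), neg_zero]
  exact ext_inner_left ℂ key

/-! ### The product and the fibres of the product system -/

variable [CompleteSpace H]

lemma fockMul_wedge_wedge (T : H →ₗᵢ[ℂ] H) (v w : List H) :
    fockMul T (wedge v) (wedge w) = wedge (w.map T ++ v.map (kerProj T)) := by
  simp only [fockMul, wedge, ContinuousLinearMap.flip_apply,
    ContinuousLinearMap.fromCompletion_apply_coe]
  simp only [preFockMulL, LinearMap.mkContinuous₂_apply, LinearMap.compr₂_apply]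
  simp only [preFockMul, preFockLift_preWedge]
  rfl

/-- The product is graded: the number of particles is additive. -/
lemma numProj_fockMul (T : H →ₗᵢ[ℂ] H) (n : ℕ) (x y : Fock H) :
    numProj n (fockMul T x y)
      = ∑ p ∈ Finset.HasAntidiagonal.antidiagonal n, fockMul T (numProj p.1 x) (numProj p.2 y) := by
  induction x using Fock.induction with
  | hc => exact isClosed_eq (by fun_prop) (by fun_prop)
  | h0 => simp
  | hadd x y hx hy => simp only [map_add, add_apply, hx, hy, Finset.sum_add_distrib]
  | hsmul c x hx => simp only [map_smul, smul_apply, hx, Finset.smul_sum]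
  | hw v =>
    induction y using Fock.induction with
    | hc => exact isClosed_eq (by fun_prop) (by fun_prop)
    | h0 => simp
    | hadd x y hx hy => simp only [map_add, hx, hy, Finset.sum_add_distrib]
    | hsmul c x hx => simp only [map_smul, hx, Finset.smul_sum]
    | hw w =>
      rw [fockMul_wedge_wedge, numProj_wedge]
      by_cases h : v.length + w.length = n
      · rw [if_pos (by simp; omega),
          Finset.sum_eq_single_of_mem (v.length, w.length) (by simpa using h)]
        · simp only [numProj_wedge, if_true, fockMul_wedge_wedge]
        · rintro ⟨i, j⟩ hij hne
          simp only [numProj_wedge]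
          split_ifs with h1 h2
          · exact absurd (by rw [h1, h2]) hne
          all_goals simp
      · rw [if_neg (by simp; omega)]
        symm
        refine Finset.sum_eq_zero ?_
        rintro ⟨i, j⟩ hij
        simp only [numProj_wedge]
        split_ifs with h1 h2
        · exact absurd (by simpa [h1, h2] using hij) h
        all_goals simp

@[elab_as_elim]
lemma carFibre_induction {T : H →ₗᵢ[ℂ] H} {p : Fock H → Prop} {z : Fock H} (hz : z ∈ carFibre T)
    (hc : IsClosed {x | p x}) (h0 : p 0) (hadd : ∀ x y, p x → p y → p (x + y))
    (hsmul : ∀ (c : ℂ) x, p x → p (c • x))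
    (hw : ∀ v : List H, (∀ x ∈ v, T.toContinuousLinearMap.adjoint x = 0) → p (wedge v)) :
    p z := by
  let S : Submodule ℂ (Fock H) :=
    { carrier := {x | p x}
      zero_mem' := h0
      add_mem' := fun {a b} ha hb => hadd a b ha hb
      smul_mem' := fun c x hx => hsmul c x hx }
  have h : carFibre T ≤ S := by
    refine Submodule.topologicalClosure_minimal _ (Submodule.span_le.mpr ?_) hc
    rintro _ ⟨v, hv, rfl⟩
    exact hw v hv
  exact h hz

lemma isClosed_carFibre (T : H →ₗᵢ[ℂ] H) : IsClosed (carFibre T : Set (Fock H)) :=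
  Submodule.isClosed_topologicalClosure _

lemma wedge_mem_carFibre {T : H →ₗᵢ[ℂ] H} {v : List H}
    (hv : ∀ x ∈ v, T.toContinuousLinearMap.adjoint x = 0) : wedge v ∈ carFibre T :=
  Submodule.le_topologicalClosure _ (Submodule.subset_span ⟨v, hv, rfl⟩)

lemma wedge_singleton_mem_carFibre {T : H →ₗᵢ[ℂ] H} {f : H}
    (hf : T.toContinuousLinearMap.adjoint f = 0) : wedge [f] ∈ carFibre T :=
  wedge_mem_carFibre (by simpa using hf)

lemma vacuum_mem_carFibre (T : H →ₗᵢ[ℂ] H) : vacuum H ∈ carFibre T :=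
  wedge_mem_carFibre (by simp)

lemma numProj_mem_carFibre {T : H →ₗᵢ[ℂ] H} {x : Fock H} (hx : x ∈ carFibre T) (n : ℕ) :
    numProj n x ∈ carFibre T := by
  refine carFibre_induction hx ?_ ?_ (fun x y hx hy => ?_) (fun c x hx => ?_)
    (fun v hv => ?_)
  · exact (isClosed_carFibre T).preimage (numProj n).continuous
  · simp
  · rw [map_add]; exact add_mem hx hy
  · rw [map_smul]; exact Submodule.smul_mem _ _ hx
  · rw [numProj_wedge]
    split_ifs
    · exact wedge_mem_carFibre hv
    · exact zero_mem _

/-- On `E(x) × E(y)` the product is the tensor product of Hilbert spaces. -/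
lemma inner_fockMul {T : H →ₗᵢ[ℂ] H} {x x' : Fock H} (hx : x ∈ carFibre T) (hx' : x' ∈ carFibre T)
    (y y' : Fock H) : ⟪fockMul T x y, fockMul T x' y'⟫_ℂ = ⟪x, x'⟫_ℂ * ⟪y, y'⟫_ℂ := by
  refine carFibre_induction hx ?_ ?_ (fun x y hx hy => ?_) (fun c x hx => ?_)
    (fun v hv => ?_)
  · exact isClosed_eq (by fun_prop) (by fun_prop)
  · simp
  · simp only [map_add, add_apply, inner_add_left, hx, hy, add_mul]
  · simp only [map_smul, smul_apply, inner_smul_left, hx, mul_assoc]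
  refine carFibre_induction hx' ?_ ?_ (fun x y hx hy => ?_) (fun c x hx => ?_)
    (fun v' hv' => ?_)
  · exact isClosed_eq (by fun_prop) (by fun_prop)
  · simp
  · simp only [map_add, add_apply, inner_add_right, hx, hy, add_mul]
  · simp only [map_smul, smul_apply, inner_smul_right, hx, mul_assoc]
  induction y using Fock.induction with
  | hc => exact isClosed_eq (by fun_prop) (by fun_prop)
  | h0 => simp
  | hadd x y hx hy => simp only [map_add, inner_add_left, hx, hy, mul_add]
  | hsmul c x hx => simp only [map_smul, inner_smul_left, hx, mul_left_comm]
  | hw w =>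
  induction y' using Fock.induction with
  | hc => exact isClosed_eq (by fun_prop) (by fun_prop)
  | h0 => simp
  | hadd x y hx hy => simp only [map_add, inner_add_right, hx, hy, mul_add]
  | hsmul c x hx => simp only [map_smul, inner_smul_right, hx, mul_left_comm]
  | hw w' =>
  rw [fockMul_wedge T v w hv, fockMul_wedge T v' w' hv', inner_wedge, inner_wedge, inner_wedge,
    wedgeKernel_append, wedgeKernel_map_isometry, mul_comm]
  · intro a ha b hb
    obtain ⟨a, -, rfl⟩ := List.mem_map.mp ha
    rw [← kerProj_of_mem T (hv' b hb)]
    exact inner_isometry_kerProj T _ _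
  · intro a ha b hb
    obtain ⟨b, -, rfl⟩ := List.mem_map.mp hb
    rw [← kerProj_of_mem T (hv a ha)]
    exact inner_kerProj_isometry T _ _

lemma norm_fockMul {T : H →ₗᵢ[ℂ] H} {x : Fock H} (hx : x ∈ carFibre T) (y : Fock H) :
    ‖fockMul T x y‖ = ‖x‖ * ‖y‖ := by
  have h := inner_fockMul hx hx y y
  rw [inner_self_eq_norm_sq_to_K, inner_self_eq_norm_sq_to_K, inner_self_eq_norm_sq_to_K,
    ← mul_pow] at h
  have h2 : ‖fockMul T x y‖ ^ 2 = (‖x‖ * ‖y‖) ^ 2 := by exact_mod_cast h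
  exact (pow_left_inj₀ (norm_nonneg _) (by positivity) two_ne_zero).mp h2

lemma fockMul_vacuum_right {T : H →ₗᵢ[ℂ] H} {x : Fock H} (hx : x ∈ carFibre T) :
    fockMul T x (vacuum H) = x := by
  refine carFibre_induction hx ?_ ?_ (fun x y hx hy => ?_) (fun c x hx => ?_)
    (fun v hv => ?_)
  · exact isClosed_eq (by fun_prop) (by fun_prop)
  · simp
  · simp only [map_add, add_apply, hx, hy]
  · simp only [map_smul, smul_apply, hx]
  · rw [vacuum, fockMul_wedge T v [] hv]; simp

lemma inner_vacuum_fockMul {T : H →ₗᵢ[ℂ] H} {x : Fock H} (hx : x ∈ carFibre T) (y : Fock H) :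
    ⟪vacuum H, fockMul T x y⟫_ℂ = ⟪vacuum H, x⟫_ℂ * ⟪vacuum H, y⟫_ℂ := by
  conv_lhs => rw [← fockMul_vacuum_right (vacuum_mem_carFibre T)]
  exact inner_fockMul (vacuum_mem_carFibre T) hx _ _

lemma fockMul_vacuum_wedge (T : H →ₗᵢ[ℂ] H) (f : H) :
    fockMul T (vacuum H) (wedge [f]) = wedge [T f] := by
  rw [vacuum, fockMul_wedge_wedge]
  simp

section Semigroup

variable {M : Type*} [AddCommMonoid M] (V : IsometrySemigroup M H)

lemma IsometrySemigroup.adjoint_add (s t : M) (f : H) :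
    (V.toFun (s + t)).toContinuousLinearMap.adjoint f
      = (V.toFun t).toContinuousLinearMap.adjoint
        ((V.toFun s).toContinuousLinearMap.adjoint f) := by
  refine ext_inner_right ℂ fun w => ?_
  rw [ContinuousLinearMap.adjoint_inner_left, ContinuousLinearMap.adjoint_inner_left,
    ContinuousLinearMap.adjoint_inner_left]
  exact congrArg _ (V.map_add s t w)

lemma kerProj_add_isometry (s t : M) (f : H) :
    kerProj (V.toFun (s + t)) (V.toFun s f) = V.toFun s (kerProj (V.toFun t) f) := by
  rw [kerProj, kerProj, V.adjoint_add, adjoint_apply_isometry, V.map_add, map_sub]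

lemma kerProj_add_kerProj (s t : M) (f : H) :
    kerProj (V.toFun (s + t)) (kerProj (V.toFun s) f) = kerProj (V.toFun s) f := by
  refine kerProj_of_mem _ ?_
  rw [V.adjoint_add, adjoint_kerProj, map_zero]

/-- Associativity of the product. -/
lemma fockMul_assoc (s t : M) (x y z : Fock H) :
    fockMul (V.toFun (s + t)) (fockMul (V.toFun s) x y) z
      = fockMul (V.toFun s) x (fockMul (V.toFun t) y z) := by
  induction x using Fock.induction with
  | hc => exact isClosed_eq (by fun_prop) (by fun_prop)
  | h0 => simp
  | hadd x y hx hy => simp only [map_add, add_apply, hx, hy]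
  | hsmul c x hx => simp only [map_smul, smul_apply, hx]
  | hw u =>
  induction y using Fock.induction with
  | hc => exact isClosed_eq (by fun_prop) (by fun_prop)
  | h0 => simp
  | hadd x y hx hy => simp only [map_add, add_apply, hx, hy]
  | hsmul c x hx => simp only [map_smul, smul_apply, hx]
  | hw v =>
  induction z using Fock.induction with
  | hc => exact isClosed_eq (by fun_prop) (by fun_prop)
  | h0 => simp
  | hadd x y hx hy => simp only [map_add, hx, hy]
  | hsmul c x hx => simp only [map_smul, hx]
  | hw w =>
  simp only [fockMul_wedge_wedge, List.map_append, List.map_map, List.append_assoc]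
  congr 2
  · exact List.map_congr_left fun f _ => V.map_add s t f
  · congr 1
    · exact List.map_congr_left fun f _ => kerProj_add_isometry V s t f
    · exact List.map_congr_left fun f _ => kerProj_add_kerProj V s t f

lemma fockMul_mem_carFibre {s t : M} {x y : Fock H} (hx : x ∈ carFibre (V.toFun s))
    (hy : y ∈ carFibre (V.toFun t)) : fockMul (V.toFun s) x y ∈ carFibre (V.toFun (s + t)) := by
  refine carFibre_induction hx ?_ ?_ (fun x y hx hy => ?_) (fun c x hx => ?_)
    (fun v hv => ?_)
  · exact (isClosed_carFibre _).preimage (by fun_prop)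
  · simp
  · rw [map_add, add_apply]
    exact add_mem hx hy
  · rw [map_smul, smul_apply]
    exact Submodule.smul_mem _ _ hx
  refine carFibre_induction hy ?_ ?_ (fun x y hx hy => ?_) (fun c x hx => ?_)
    (fun w hw => ?_)
  · exact (isClosed_carFibre _).preimage (by fun_prop)
  · simp
  · rw [map_add]; exact add_mem hx hy
  · rw [map_smul]; exact Submodule.smul_mem _ _ hx
  · rw [fockMul_wedge _ v w hv]
    refine wedge_mem_carFibre fun f hf => ?_
    rcases List.mem_append.mp hf with h | h
    · obtain ⟨g, hg, rfl⟩ := List.mem_map.mp h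
      rw [V.adjoint_add, adjoint_apply_isometry, hw g hg]
    · rw [V.adjoint_add, hv f h, map_zero]

lemma carFibre_le_add (s t : M) : carFibre (V.toFun s) ≤ carFibre (V.toFun (s + t)) := by
  intro x hx
  rw [← fockMul_vacuum_right hx]
  exact fockMul_mem_carFibre V hx (vacuum_mem_carFibre _)

end Semigroup

end FockSpace

section Exponential

variable {H : Type*} [NormedAddCommGroup H] [InnerProductSpace ℂ H] [CompleteSpace H]

/-! ### Coherent sections and exponentials -/

lemma numProj_zero_fockMul (T : H →ₗᵢ[ℂ] H) (x y : Fock H) :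
    numProj 0 (fockMul T x y) = fockMul T (numProj 0 x) (numProj 0 y) := by
  rw [numProj_fockMul]
  simp

lemma numProj_one_fockMul (T : H →ₗᵢ[ℂ] H) (x y : Fock H) :
    numProj 1 (fockMul T x y)
      = fockMul T (numProj 0 x) (numProj 1 y) + fockMul T (numProj 1 x) (numProj 0 y) := by
  rw [numProj_fockMul, Finset.Nat.antidiagonal_succ]
  simp

lemma nat_mul_div_le {i k : ℕ} (h : i ≤ k) (s : ℝ≥0) : (i : ℝ≥0) * s / k ≤ s := by
  refine div_le_of_le_mul₀ (by positivity) (by positivity) ?_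
  rw [mul_comm s]
  gcongr

lemma nat_mul_div_le_succ (i k : ℕ) (s : ℝ≥0) : (i : ℝ≥0) * s / k ≤ ((i : ℝ≥0) + 1) * s / k := by
  gcongr
  simp

lemma nat_succ_mul_div_le {i k : ℕ} (h : i < k) (s : ℝ≥0) :
    ((i : ℝ≥0) + 1) * s / k ≤ s := by
  have := nat_mul_div_le (Nat.succ_le_of_lt h) s
  push_cast at this
  exact this

variable {W : IsometrySemigroup ℝ≥0 H} {t : ℝ≥0}

section Coherent

variable {bs : ℝ≥0 → Fock H} {β : ℝ≥0 → ℝ≥0 → Fock H}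

lemma IsCoherentSection.inner_vacuum (h : IsCoherentSection W t bs β) {s : ℝ≥0} (hs : s ≤ t) :
    ⟪vacuum H, bs s⟫_ℂ = 0 := (h.1 s hs).2.1

lemma IsCoherentSection.mem (h : IsCoherentSection W t bs β) {s : ℝ≥0} (hs : s ≤ t) :
    bs s ∈ carFibre (W.toFun s) := (h.1 s hs).1

lemma IsCoherentSection.eq_add (h : IsCoherentSection W t bs β) {r s : ℝ≥0} (hr : r ≤ s)
    (hs : s ≤ t) : bs s = bs r + fockMul (W.toFun r) (vacuum H) (β r s) := by
  conv_lhs => rw [(h.2 r s hr hs).2, fockMul_vacuum_right (h.mem (hr.trans hs))]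

lemma IsCoherentSection.inner_vacuum_increment (h : IsCoherentSection W t bs β) {r s : ℝ≥0}
    (hr : r ≤ s) (hs : s ≤ t) : ⟪vacuum H, β r s⟫_ℂ = 0 := by
  have h1 := h.inner_vacuum hs
  rw [h.eq_add hr hs, inner_add_right, h.inner_vacuum (hr.trans hs), zero_add,
    inner_vacuum_fockMul (vacuum_mem_carFibre _), inner_vacuum_self, one_mul] at h1
  exact h1

/-- A coherent section is determined by its value at the final time: `b_r` is the component of `b_t`
in `E(r)`, because `Ω · β r t` is orthogonal to every vector of `E(r)` orthogonal to the vacuum. -/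
lemma IsCoherentSection.section_unique {bs' : ℝ≥0 → Fock H} {β' : ℝ≥0 → ℝ≥0 → Fock H}
    (h : IsCoherentSection W t bs β) (h' : IsCoherentSection W t bs' β') (ht : bs t = bs' t)
    {r : ℝ≥0} (hr : r ≤ t) : bs r = bs' r := by
  have e : bs r - bs' r = fockMul (W.toFun r) (vacuum H) (β' r t - β r t) := by
    rw [map_sub, sub_eq_sub_iff_add_eq_add, ← h.eq_add hr le_rfl, ht, h'.eq_add hr le_rfl, add_comm]
  have hm : bs r - bs' r ∈ carFibre (W.toFun r) := sub_mem (h.mem hr) (h'.mem hr)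
  have h0 : ⟪bs r - bs' r, bs r - bs' r⟫_ℂ = 0 := by
    calc ⟪bs r - bs' r, bs r - bs' r⟫_ℂ
        = ⟪fockMul (W.toFun r) (bs r - bs' r) (vacuum H),
            fockMul (W.toFun r) (vacuum H) (β' r t - β r t)⟫_ℂ := by
          rw [fockMul_vacuum_right hm, ← e]
      _ = 0 := by
          rw [inner_fockMul hm (vacuum_mem_carFibre _), inner_sub_right (vacuum H),
            h.inner_vacuum_increment hr le_rfl, h'.inner_vacuum_increment hr le_rfl, sub_zero,
            mul_zero]
  exact sub_eq_zero.mp (inner_self_eq_zero.mp h0)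

lemma IsCoherentSection.increment_unique {bs' : ℝ≥0 → Fock H} {β' : ℝ≥0 → ℝ≥0 → Fock H}
    (h : IsCoherentSection W t bs β) (h' : IsCoherentSection W t bs' β') (ht : bs t = bs' t)
    {r s : ℝ≥0} (hr : r ≤ s) (hs : s ≤ t) : β r s = β' r s := by
  have h1 := h.eq_add hr hs
  rw [h.section_unique h' ht hs, h.section_unique h' ht (hr.trans hs), h'.eq_add hr hs,
    add_right_inj] at h1
  have h2 : ‖fockMul (W.toFun r) (vacuum H) (β' r s - β r s)‖ = 0 := by
    rw [map_sub, h1, sub_self, norm_zero]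
  rw [norm_fockMul (vacuum_mem_carFibre _), norm_vacuum, one_mul, norm_eq_zero, sub_eq_zero] at h2
  exact h2.symm

end Coherent

lemma itoSum_congr {β β' : ℝ≥0 → ℝ≥0 → Fock H} {x x' : ℝ≥0 → Fock H} {s : ℝ≥0}
    (hβ : ∀ r r', r ≤ r' → r' ≤ s → β r r' = β' r r') (hx : ∀ r ≤ s, x r = x' r) (k : ℕ) :
    itoSum W β x s k = itoSum W β' x' s k := by
  refine Finset.sum_congr rfl fun i hi => ?_
  have hi := Finset.mem_range.mp hi
  rw [hx _ (nat_mul_div_le hi.le s), hβ _ _ (nat_mul_div_le_succ i k s) (nat_succ_mul_div_le hi s)]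

lemma IsExponential.unique {b z z' : Fock H} (h : IsExponential W t b z)
    (h' : IsExponential W t b z') : z = z' := by
  obtain ⟨bs, β, x, hc, hb, h0, h1, hn, hz⟩ := h
  obtain ⟨bs', β', x', hc', hb', h0', h1', hn', hz'⟩ := h'
  have ht : bs t = bs' t := hb.trans hb'.symm
  have hx1 : ∀ n, ∀ s ≤ t, x (n + 1) s = x' (n + 1) s := by
    intro n
    induction n with
    | zero => exact fun s hs => by rw [h1 s hs, h1' s hs, hc.section_unique hc' ht hs]
    | succ n ih =>
      intro s hs
      refine tendsto_nhds_unique (hn (n + 1) (by omega) s hs) ?_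
      refine (hn' (n + 1) (by omega) s hs).congr fun k => ?_
      refine itoSum_congr (fun r r' hr hr' => ?_) (fun r hr => ?_) k
      · exact (hc.increment_unique hc' ht hr (hr'.trans hs)).symm
      · exact (ih r (hr.trans hs)).symm
  have hx : ∀ n, x n t = x' n t := by
    rintro (_ | n)
    · rw [h0 t le_rfl, h0' t le_rfl]
    · exact hx1 n t le_rfl
  exact hz.unique (by simpa only [hx] using hz')

/-- The one-particle component of the exponential of a one-particle vector `f` is `f`. -/
lemma IsExponential.numProj_one {f : H} {z : Fock H} (h : IsExponential W t (wedge [f]) z) :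
    numProj 1 z = wedge [f] := by
  obtain ⟨bs, β, x, hc, hb, h0, h1, hn, hz⟩ := h
  have hβ : ∀ r s, r ≤ s → s ≤ t →
      numProj 0 (fockMul (W.toFun (s - r)) (β r s) (vacuum H)) = 0 := by
    intro r s hr hs
    rw [numProj_zero_fockMul, numProj_zero (β r s), hc.inner_vacuum_increment hr hs]
    simp
  have hx0 : ∀ n, ∀ s ≤ t, numProj 0 (x (n + 1) s) = 0 := by
    intro n
    cases n with
    | zero => exact fun s hs => by rw [h1 s hs, numProj_zero, hc.inner_vacuum hs, zero_smul]
    | succ n =>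
      intro s hs
      have h2 := ((numProj 0).continuous.tendsto _).comp (hn (n + 1) (by omega) s hs)
      refine tendsto_nhds_unique h2 ?_
      refine tendsto_const_nhds.congr fun k => ?_
      rw [Function.comp_apply, itoSum, map_sum]
      refine (Finset.sum_eq_zero fun i hi => ?_).symm
      have hi := Finset.mem_range.mp hi
      rw [numProj_zero_fockMul, hβ _ _ (nat_mul_div_le_succ i k s)
        ((nat_succ_mul_div_le hi s).trans hs), map_zero]
  have hx1 : ∀ n, numProj 1 (x (n + 2) t) = 0 := by
    intro n
    have h2 := ((numProj 1).continuous.tendsto _).comp (hn (n + 1) (by omega) t le_rfl)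
    refine tendsto_nhds_unique h2 ?_
    refine tendsto_const_nhds.congr fun k => ?_
    rw [Function.comp_apply, itoSum, map_sum]
    refine (Finset.sum_eq_zero fun i hi => ?_).symm
    have hi := Finset.mem_range.mp hi
    rw [numProj_one_fockMul, hβ _ _ (nat_mul_div_le_succ i k t) (nat_succ_mul_div_le hi t),
      hx0 n _ (nat_mul_div_le hi.le t)]
    simp
  refine (hz.mapL (numProj 1)).unique ?_
  have : ∀ n, n ≠ 1 → numProj 1 (x n t) = 0 := by
    rintro (_ | _ | n) hne
    · rw [h0 t le_rfl, numProj_vacuum, if_neg one_ne_zero]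
    · exact absurd rfl hne
    · exact hx1 n
  convert hasSum_single 1 this using 1
  rw [h1 t le_rfl, hb, numProj_wedge, if_pos (List.length_singleton)]

end Exponential

section ProductIntegral

variable {H : Type*} [NormedAddCommGroup H] [InnerProductSpace ℂ H] [CompleteSpace H]

/-! ### Product integrals of stationary cocycles -/

lemma IsometrySemigroup.toFun_zero {M : Type*} [AddCommMonoid M] (V : IsometrySemigroup M H)
    (f : H) : V.toFun 0 f = f := by
  refine (V.toFun 0).injective ?_
  rw [← V.map_add, add_zero]

lemma fockMul_zero_vacuum {M : Type*} [AddCommMonoid M] (V : IsometrySemigroup M H) (y : Fock H) :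
    fockMul (V.toFun 0) (vacuum H) y = y := by
  induction y using Fock.induction with
  | hc => exact isClosed_eq (by fun_prop) (by fun_prop)
  | h0 => simp
  | hadd x y hx hy => simp only [map_add, hx, hy]
  | hsmul c x hx => simp only [map_smul, hx]
  | hw v =>
    rw [vacuum, fockMul_wedge_wedge, List.map_nil, List.append_nil]
    exact congrArg _ ((List.map_congr_left fun f _ => V.toFun_zero f).trans (List.map_id v))

/-- `(η_s)` is a one-particle cocycle of `W` with orthogonal increments, whose variance is
proportional to time with constant `c`. -/
structure IsStationaryCocycle (W : IsometrySemigroup ℝ≥0 H) (η : ℝ≥0 → H) (c : ℝ≥0) : Prop where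
  add : ∀ s t, η (s + t) = η s + W.toFun s (η t)
  adjoint_eq_zero : ∀ s, (W.toFun s).toContinuousLinearMap.adjoint (η s) = 0
  norm_sq : ∀ s, ‖η s‖ ^ 2 = c * s

/-- The product `(Ω + η_{h₁}) · (Ω + η_{h₂}) ⋯ (Ω + η_{hₖ})` over the steps `h₁, …, hₖ` of a
partition of `[0, h₁ + ⋯ + hₖ]`. -/
def stepExp (W : IsometrySemigroup ℝ≥0 H) (η : ℝ≥0 → H) : List ℝ≥0 → Fock H
  | [] => vacuum H
  | h :: L => fockMul (W.toFun h) (vacuum H + wedge [η h]) (stepExp W η L)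

/-- `Refines L M`: the partition with steps `L` refines the partition with steps `M`, that is, `L`
is a concatenation of lists whose sums are the entries of `M`. -/
inductive Refines : List ℝ≥0 → List ℝ≥0 → Prop
  | nil : Refines [] []
  | cons {L M : List ℝ≥0} (N : List ℝ≥0) : Refines L M → Refines (N ++ L) (N.sum :: M)

lemma Refines.refl (L : List ℝ≥0) : Refines L L := by
  induction L with
  | nil => exact .nil
  | cons h L ih => simpa using Refines.cons [h] ih

lemma Refines.sum_eq {L M : List ℝ≥0} (h : Refines L M) : L.sum = M.sum := by
  induction h with
  | nil => rfl
  | cons N _ ih => rw [List.sum_append, List.sum_cons, ih]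

/-- Two partitions of the same interval have a common refinement: cut off the shorter of the two
first steps and recurse. -/
lemma exists_common_refinement : ∀ L M : List ℝ≥0, L.sum = M.sum →
    ∃ N, Refines N L ∧ Refines N M
  | [], [], _ => ⟨[], .nil, .nil⟩
  | [], g :: M, h => by
    rw [List.sum_nil, List.sum_cons] at h
    have hg : g = 0 := (add_eq_zero.mp h.symm).1
    have hM : M.sum = 0 := (add_eq_zero.mp h.symm).2
    obtain ⟨N, h1, h2⟩ := exists_common_refinement [] M (by rw [hM, List.sum_nil])
    exact ⟨N, h1, by simpa [hg] using Refines.cons [] h2⟩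
  | g :: L, [], h => by
    rw [List.sum_nil, List.sum_cons] at h
    have hg : g = 0 := (add_eq_zero.mp h).1
    have hM : L.sum = 0 := (add_eq_zero.mp h).2
    obtain ⟨N, h1, h2⟩ := exists_common_refinement L [] (by rw [hM, List.sum_nil])
    exact ⟨N, by simpa [hg] using Refines.cons [] h1, h2⟩
  | a :: L, b :: M, h => by
    rw [List.sum_cons, List.sum_cons] at h
    rcases le_total a b with hab | hab
    · have e : a + (b - a) = b := add_tsub_cancel_of_le hab
      obtain ⟨N, h1, h2⟩ := exists_common_refinement L ((b - a) :: M) (by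
        rw [List.sum_cons]
        refine add_left_cancel (a := a) ?_
        rw [h, ← add_assoc, e])
      refine ⟨a :: N, by simpa using Refines.cons [a] h1, ?_⟩
      generalize hx : b - a = x at h2 e
      cases h2 with
      | cons N' h3 =>
        rw [← e]
        exact Refines.cons (a :: N') h3
    · have e : b + (a - b) = a := add_tsub_cancel_of_le hab
      obtain ⟨N, h1, h2⟩ := exists_common_refinement ((a - b) :: L) M (by
        rw [List.sum_cons]
        refine add_left_cancel (a := b) ?_
        rw [← h, ← add_assoc, e])
      refine ⟨b :: N, ?_, by simpa using Refines.cons [b] h2⟩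
      generalize hx : a - b = x at h1 e
      cases h1 with
      | cons N' h3 =>
        rw [← e]
        exact Refines.cons (b :: N') h3
  termination_by L M => L.length + M.length

/-- The squared norm `∏ (1 + c h)` of a step exponential. -/
def stepGrowth (c : ℝ≥0) (L : List ℝ≥0) : ℝ := (L.map fun h : ℝ≥0 => 1 + (c : ℝ) * h).prod

lemma stepGrowth_append (c : ℝ≥0) (L M : List ℝ≥0) :
    stepGrowth c (L ++ M) = stepGrowth c L * stepGrowth c M := by
  simp [stepGrowth]

lemma stepGrowth_nonneg (c : ℝ≥0) (L : List ℝ≥0) : 0 ≤ stepGrowth c L := by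
  refine List.prod_nonneg ?_
  intro a ha
  obtain ⟨h, -, rfl⟩ := List.mem_map.mp ha
  positivity

lemma stepGrowth_le_exp (c : ℝ≥0) (L : List ℝ≥0) :
    stepGrowth c L ≤ Real.exp (c * (L.sum : ℝ≥0)) := by
  induction L with
  | nil => simp [stepGrowth]
  | cons h L ih =>
    have e : stepGrowth c (h :: L) = (1 + (c : ℝ) * h) * stepGrowth c L := by simp [stepGrowth]
    rw [e, List.sum_cons, NNReal.coe_add, mul_add, Real.exp_add]
    have := Real.add_one_le_exp ((c : ℝ) * h)
    exact mul_le_mul (by linarith) ih (stepGrowth_nonneg c L) (Real.exp_nonneg _)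

variable {W : IsometrySemigroup ℝ≥0 H} {η : ℝ≥0 → H} {c : ℝ≥0}

namespace IsStationaryCocycle

lemma first_order_mem (hη : IsStationaryCocycle W η c) (h : ℝ≥0) :
    vacuum H + wedge [η h] ∈ carFibre (W.toFun h) :=
  add_mem (vacuum_mem_carFibre _) (wedge_singleton_mem_carFibre (hη.adjoint_eq_zero h))

lemma stepExp_mem (hη : IsStationaryCocycle W η c) (L : List ℝ≥0) :
    stepExp W η L ∈ carFibre (W.toFun L.sum) := by
  induction L with
  | nil => exact vacuum_mem_carFibre _
  | cons h L ih =>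
    rw [List.sum_cons]
    exact fockMul_mem_carFibre W (hη.first_order_mem h) ih

lemma stepExp_append (L M : List ℝ≥0) :
    stepExp W η (L ++ M) = fockMul (W.toFun L.sum) (stepExp W η L) (stepExp W η M) := by
  induction L with
  | nil => exact (fockMul_zero_vacuum W _).symm
  | cons h L ih =>
    rw [List.cons_append, stepExp, ih, List.sum_cons, stepExp, fockMul_assoc]

lemma numProj_zero_stepExp (W : IsometrySemigroup ℝ≥0 H) (η : ℝ≥0 → H) (L : List ℝ≥0) :
    numProj 0 (stepExp W η L) = vacuum H := by
  induction L with
  | nil => rw [stepExp, numProj_vacuum, if_pos rfl]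
  | cons h L ih =>
    rw [stepExp, numProj_zero_fockMul, ih, map_add, numProj_vacuum, if_pos rfl, numProj_wedge,
      if_neg (by simp), add_zero, fockMul_vacuum_right (vacuum_mem_carFibre _)]

lemma map_zero_eq (hη : IsStationaryCocycle W η c) : η 0 = 0 := by
  have h := hη.norm_sq 0
  simpa using h

lemma numProj_one_stepExp (hη : IsStationaryCocycle W η c) (L : List ℝ≥0) :
    numProj 1 (stepExp W η L) = wedge [η L.sum] := by
  induction L with
  | nil =>
    rw [stepExp, numProj_vacuum, if_neg one_ne_zero, List.sum_nil, hη.map_zero_eq,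
      wedge_singleton_zero]
  | cons h L ih =>
    have h0 : numProj 0 (vacuum H + wedge [η h]) = vacuum H := by
      rw [map_add, numProj_vacuum, if_pos rfl, numProj_wedge, if_neg (by simp), add_zero]
    have h1 : numProj 1 (vacuum H + wedge [η h]) = wedge [η h] := by
      rw [map_add, numProj_vacuum, if_neg one_ne_zero, numProj_wedge, if_pos (by simp), zero_add]
    rw [stepExp, numProj_one_fockMul, ih, h0, h1, numProj_zero_stepExp, fockMul_vacuum_wedge,
      fockMul_vacuum_right (wedge_singleton_mem_carFibre (hη.adjoint_eq_zero h)), List.sum_cons,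
      hη.add, wedge_add, add_comm]

lemma inner_first_order (hη : IsStationaryCocycle W η c) {h : ℝ≥0} {z : Fock H}
    (h0 : numProj 0 z = vacuum H) (h1 : numProj 1 z = wedge [η h]) :
    ⟪vacuum H + wedge [η h], z⟫_ℂ = ((1 + (c : ℝ) * h : ℝ) : ℂ) := by
  have e0 : ⟪vacuum H, z⟫_ℂ = 1 := by
    rw [← inner_vacuum_self (H := H)]
    nth_rewrite 3 [← h0]
    rw [← inner_numProj_left, numProj_vacuum, if_pos rfl]
  have e1 : ⟪wedge [η h], z⟫_ℂ = ((c : ℝ) * h : ℝ) := by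
    have : wedge [η h] = numProj 1 (wedge [η h]) := by rw [numProj_wedge, if_pos (by simp)]
    rw [this, inner_numProj_left, h1, inner_wedge_singleton, inner_self_eq_norm_sq_to_K,
      ← hη.norm_sq h]
    push_cast
    rfl
  rw [inner_add_left, e0, e1]
  push_cast
  rfl

/-- Refining a partition changes the step exponential by a vector orthogonal to it. -/
lemma inner_stepExp_of_refines (hη : IsStationaryCocycle W η c) {L M : List ℝ≥0}
    (h : Refines L M) : ⟪stepExp W η M, stepExp W η L⟫_ℂ = (stepGrowth c M : ℂ) := by
  induction h with
  | nil => simp [stepExp, stepGrowth, norm_vacuum]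
  | @cons L M N _ ih =>
    rw [stepExp_append, stepExp, inner_fockMul (hη.first_order_mem _) (hη.stepExp_mem N), ih,
      hη.inner_first_order (numProj_zero_stepExp W η N) (hη.numProj_one_stepExp N)]
    simp [stepGrowth]

lemma norm_sq_stepExp (hη : IsStationaryCocycle W η c) (L : List ℝ≥0) :
    ‖stepExp W η L‖ ^ 2 = stepGrowth c L := by
  have h := hη.inner_stepExp_of_refines (Refines.refl L)
  rw [inner_self_eq_norm_sq_to_K] at h
  have h2 : ((‖stepExp W η L‖ ^ 2 : ℝ) : ℂ) = (stepGrowth c L : ℂ) := by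
    rw [← h]; push_cast; rfl
  exact Complex.ofReal_injective h2

lemma norm_sub_le_of_refines (hη : IsStationaryCocycle W η c) {L M : List ℝ≥0}
    (h : Refines L M) : ‖stepExp W η L - stepExp W η M‖ ≤
      √(Real.exp (c * (M.sum : ℝ≥0)) - stepGrowth c M) := by
  refine Real.le_sqrt_of_sq_le ?_
  rw [norm_sub_rev, @norm_sub_sq ℂ, hη.inner_stepExp_of_refines h, hη.norm_sq_stepExp,
    hη.norm_sq_stepExp, ← h.sum_eq]
  have := stepGrowth_le_exp c L
  simp only [RCLike.re_to_complex, Complex.ofReal_re]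
  linarith

lemma norm_stepExp_sub_le (hη : IsStationaryCocycle W η c) {L M : List ℝ≥0} {s : ℝ≥0}
    (hL : L.sum = s) (hM : M.sum = s) : ‖stepExp W η L - stepExp W η M‖ ≤
      √(Real.exp (c * s) - stepGrowth c L) + √(Real.exp (c * s) - stepGrowth c M) := by
  obtain ⟨N, h1, h2⟩ := exists_common_refinement L M (hL.trans hM.symm)
  have e1 := hη.norm_sub_le_of_refines h1
  have e2 := hη.norm_sub_le_of_refines h2
  rw [norm_sub_rev] at e1
  rw [hL] at e1
  rw [hM] at e2
  calc _ = ‖(stepExp W η L - stepExp W η N) + (stepExp W η N - stepExp W η M)‖ := by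
        rw [sub_add_sub_cancel]
    _ ≤ _ := norm_add_le _ _
    _ ≤ _ := add_le_add e1 e2

end IsStationaryCocycle

/-- The partition of `[0, s]` into `k + 1` equal steps. -/
def equalSteps (s : ℝ≥0) (k : ℕ) : List ℝ≥0 := List.replicate (k + 1) (s / (k + 1 : ℕ))

lemma sum_equalSteps (s : ℝ≥0) (k : ℕ) : (equalSteps s k).sum = s := by
  have : ((k + 1 : ℕ) : ℝ≥0) ≠ 0 := by positivity
  rw [equalSteps, List.sum_replicate, nsmul_eq_mul, mul_div_cancel₀ _ this]

lemma tendsto_stepGrowth_equalSteps (c s : ℝ≥0) :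
    Tendsto (fun k => stepGrowth c (equalSteps s k)) atTop (𝓝 (Real.exp (c * s))) := by
  refine ((Real.tendsto_one_add_div_pow_exp ((c : ℝ) * s)).comp (tendsto_add_atTop_nat 1)).congr
    fun k => ?_
  simp [stepGrowth, equalSteps, mul_div_assoc]

/-- The product integral `lim (Ω + η_{s/k})^k` of the cocycle `η` over `[0, s]`. -/
def productExp (W : IsometrySemigroup ℝ≥0 H) (η : ℝ≥0 → H) (s : ℝ≥0) : Fock H :=
  limUnder atTop fun k => stepExp W η (equalSteps s k)

namespace IsStationaryCocycle

lemma tendsto_productExp (hη : IsStationaryCocycle W η c) (s : ℝ≥0) :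
    Tendsto (fun k => stepExp W η (equalSteps s k)) atTop (𝓝 (productExp W η s)) := by
  refine CauchySeq.tendsto_limUnder ?_
  rw [cauchySeq_iff_tendsto_dist_atTop_0]
  have hd : Tendsto (fun k => √(Real.exp (c * s) - stepGrowth c (equalSteps s k))) atTop (𝓝 0) := by
    have := ((tendsto_stepGrowth_equalSteps c s).const_sub (Real.exp (c * s))).sqrt
    simpa using this
  have h2 : Tendsto (fun n : ℕ × ℕ => √(Real.exp (c * s) - stepGrowth c (equalSteps s n.1))
      + √(Real.exp (c * s) - stepGrowth c (equalSteps s n.2))) atTop (𝓝 0) := by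
    rw [← prod_atTop_atTop_eq]
    simpa using (hd.comp tendsto_fst).add (hd.comp tendsto_snd)
  refine squeeze_zero (fun _ => dist_nonneg) (fun n => ?_) h2
  rw [dist_eq_norm]
  exact hη.norm_stepExp_sub_le (sum_equalSteps s n.1) (sum_equalSteps s n.2)

lemma productExp_mem (hη : IsStationaryCocycle W η c) (s : ℝ≥0) :
    productExp W η s ∈ carFibre (W.toFun s) := by
  refine (isClosed_carFibre _).mem_of_tendsto (hη.tendsto_productExp s) (Eventually.of_forall ?_)
  intro k
  have := hη.stepExp_mem (equalSteps s k)
  rwa [sum_equalSteps] at this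

lemma numProj_zero_productExp (hη : IsStationaryCocycle W η c) (s : ℝ≥0) :
    numProj 0 (productExp W η s) = vacuum H := by
  refine tendsto_nhds_unique (((numProj 0).continuous.tendsto _).comp (hη.tendsto_productExp s)) ?_
  exact tendsto_const_nhds.congr fun k => (numProj_zero_stepExp W η _).symm

lemma numProj_one_productExp (hη : IsStationaryCocycle W η c) (s : ℝ≥0) :
    numProj 1 (productExp W η s) = wedge [η s] := by
  refine tendsto_nhds_unique (((numProj 1).continuous.tendsto _).comp (hη.tendsto_productExp s)) ?_
  refine tendsto_const_nhds.congr fun k => ?_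
  rw [Function.comp_apply, hη.numProj_one_stepExp, sum_equalSteps]

lemma norm_sq_productExp (hη : IsStationaryCocycle W η c) (s : ℝ≥0) :
    ‖productExp W η s‖ ^ 2 = Real.exp (c * s) := by
  refine tendsto_nhds_unique ((hη.tendsto_productExp s).norm.pow 2) ?_
  exact (tendsto_stepGrowth_equalSteps c s).congr fun k => (hη.norm_sq_stepExp _).symm

lemma productExp_add (hη : IsStationaryCocycle W η c) (s t : ℝ≥0) :
    fockMul (W.toFun s) (productExp W η s) (productExp W η t) = productExp W η (s + t) := by
  have hc : Continuous fun p : Fock H × Fock H => fockMul (W.toFun s) p.1 p.2 := by fun_prop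
  have h1 := (hc.tendsto _).comp
    ((hη.tendsto_productExp s).prodMk_nhds (hη.tendsto_productExp t))
  refine tendsto_nhds_unique h1 ?_
  have e : ∀ k, fockMul (W.toFun s) (stepExp W η (equalSteps s k)) (stepExp W η (equalSteps t k))
      = stepExp W η (equalSteps s k ++ equalSteps t k) := by
    intro k
    rw [stepExp_append, sum_equalSteps]
  have hlim : Tendsto (fun k => stepGrowth c (equalSteps s k ++ equalSteps t k)) atTop
      (𝓝 (Real.exp (c * (s + t : ℝ≥0)))) := by
    simp only [stepGrowth_append, NNReal.coe_add, mul_add, Real.exp_add]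
    exact (tendsto_stepGrowth_equalSteps c s).mul (tendsto_stepGrowth_equalSteps c t)
  have hd : Tendsto (fun k =>
      √(Real.exp (c * (s + t : ℝ≥0)) - stepGrowth c (equalSteps s k ++ equalSteps t k))
      + √(Real.exp (c * (s + t : ℝ≥0)) - stepGrowth c (equalSteps (s + t) k))) atTop (𝓝 0) := by
    simpa using (hlim.const_sub (Real.exp (c * (s + t : ℝ≥0)))).sqrt.add
      ((tendsto_stepGrowth_equalSteps c (s + t)).const_sub (Real.exp (c * (s + t : ℝ≥0)))).sqrt
  have h2 : Tendsto (fun k => stepExp W η (equalSteps s k ++ equalSteps t k)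
      - stepExp W η (equalSteps (s + t) k)) atTop (𝓝 0) := by
    refine squeeze_zero_norm (fun k => ?_) hd
    refine hη.norm_stepExp_sub_le ?_ (sum_equalSteps _ _)
    rw [List.sum_append, sum_equalSteps, sum_equalSteps]
  have h3 := h2.add (hη.tendsto_productExp (s + t))
  simp only [sub_add_cancel, zero_add] at h3
  exact h3.congr fun k => (e k).symm

lemma inner_productExp_of_le (hη : IsStationaryCocycle W η c) {s t : ℝ≥0} (hst : s ≤ t) :
    ⟪productExp W η s, productExp W η t⟫_ℂ = (Real.exp (c * s) : ℂ) := by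
  have h0 : ⟪vacuum H, productExp W η (t - s)⟫_ℂ = 1 := by
    rw [← inner_vacuum_self (H := H)]
    nth_rewrite 3 [← hη.numProj_zero_productExp (t - s)]
    rw [← inner_numProj_left, numProj_vacuum, if_pos rfl]
  calc ⟪productExp W η s, productExp W η t⟫_ℂ
      = ⟪fockMul (W.toFun s) (productExp W η s) (vacuum H),
          fockMul (W.toFun s) (productExp W η s) (productExp W η (t - s))⟫_ℂ := by
        rw [fockMul_vacuum_right (hη.productExp_mem s), hη.productExp_add,
          add_tsub_cancel_of_le hst]
    _ = _ := by
        rw [inner_fockMul (hη.productExp_mem s) (hη.productExp_mem s), h0, mul_one,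
          inner_self_eq_norm_sq_to_K, ← hη.norm_sq_productExp]
        push_cast
        rfl

lemma norm_productExp_sub_sq (hη : IsStationaryCocycle W η c) (s t : ℝ≥0) :
    ‖productExp W η s - productExp W η t‖ ^ 2 = |Real.exp (c * s) - Real.exp (c * t)| := by
  have key : ∀ {s t : ℝ≥0}, s ≤ t → ‖productExp W η s - productExp W η t‖ ^ 2
      = |Real.exp (c * s) - Real.exp (c * t)| := by
    intro s t hst
    rw [@norm_sub_sq ℂ, hη.inner_productExp_of_le hst, hη.norm_sq_productExp,
      hη.norm_sq_productExp, RCLike.re_to_complex, Complex.ofReal_re, abs_sub_comm, abs_of_nonneg]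
    · ring
    · rw [sub_nonneg, Real.exp_le_exp]
      gcongr
  rcases le_total s t with h | h
  · exact key h
  · rw [norm_sub_rev, key h, abs_sub_comm]

lemma continuous_productExp (hη : IsStationaryCocycle W η c) : Continuous (productExp W η) := by
  rw [continuous_iff_continuousAt]
  intro t
  rw [ContinuousAt, tendsto_iff_norm_sub_tendsto_zero]
  have h1 : Continuous fun s : ℝ≥0 => √|Real.exp (c * s) - Real.exp (c * t)| := by fun_prop
  have h2 := h1.tendsto t
  simp only [sub_self, abs_zero, Real.sqrt_zero] at h2
  refine h2.congr fun s => ?_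
  rw [← hη.norm_productExp_sub_sq, Real.sqrt_sq (norm_nonneg _)]

end IsStationaryCocycle

end ProductIntegral

section ItoIntegral

variable {H : Type*} [NormedAddCommGroup H] [InnerProductSpace ℂ H] [CompleteSpace H]
  {W : IsometrySemigroup ℝ≥0 H} {η : ℝ≥0 → H} {c : ℝ≥0} {E : ℝ≥0 → Fock H}

/-! ### Itô integrals of the particle components of a unit -/

lemma numProj_succ_fockMul_wedge (T : H →ₗᵢ[ℂ] H) (n : ℕ) (x : Fock H) (f : H) :
    numProj (n + 1) (fockMul T x (wedge [f])) = fockMul T (numProj n x) (wedge [f]) := by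
  rw [numProj_fockMul, Finset.sum_eq_single_of_mem (n, 1) (by simp)]
  · simp [numProj_wedge]
  · rintro ⟨i, j⟩ hij hne
    have hj : j ≠ 1 := by
      rintro rfl
      exact hne (by simpa using hij)
    simp [numProj_wedge, Ne.symm hj]

/-- `E` is a unit of the one-parameter product system of `W`, normalised to have vacuum component
`Ω`, whose one-particle component is the cocycle `η` and whose squared norm is `exp (c s)`. -/
structure IsExponentialUnit (W : IsometrySemigroup ℝ≥0 H) (η : ℝ≥0 → H) (c : ℝ≥0)
    (E : ℝ≥0 → Fock H) : Prop where
  mem : ∀ s, E s ∈ carFibre (W.toFun s)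
  numProj_zero : ∀ s, numProj 0 (E s) = vacuum H
  numProj_one : ∀ s, numProj 1 (E s) = wedge [η s]
  norm_sq : ∀ s, ‖E s‖ ^ 2 = Real.exp (c * s)
  mul : ∀ s t, fockMul (W.toFun s) (E s) (E t) = E (s + t)

namespace IsExponentialUnit

variable (hη : IsStationaryCocycle W η c) (hE : IsExponentialUnit W η c E)

include hη hE

lemma norm_sub_first_order_sq (h : ℝ≥0) :
    ‖E h - (vacuum H + wedge [η h])‖ ^ 2 = Real.exp (c * h) - 1 - c * h := by
  have h0 : numProj 0 (vacuum H + wedge [η h]) = vacuum H := by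
    rw [map_add, numProj_vacuum, if_pos rfl, numProj_wedge, if_neg (by simp), add_zero]
  have h1 : numProj 1 (vacuum H + wedge [η h]) = wedge [η h] := by
    rw [map_add, numProj_vacuum, if_neg one_ne_zero, numProj_wedge, if_pos (by simp), zero_add]
  have hu : ‖vacuum H + wedge [η h]‖ ^ 2 = 1 + (c : ℝ) * h := by
    have := hη.inner_first_order h0 h1
    rw [inner_self_eq_norm_sq_to_K] at this
    refine Complex.ofReal_injective ?_
    rw [← this]
    push_cast
    rfl
  rw [norm_sub_rev, @norm_sub_sq ℂ, hη.inner_first_order (hE.numProj_zero h) (hE.numProj_one h),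
    hE.norm_sq, hu, RCLike.re_to_complex, Complex.ofReal_re]
  ring

lemma apply_zero : E 0 = vacuum H := by
  have h := hE.norm_sub_first_order_sq hη 0
  simpa [hη.map_zero_eq, wedge_singleton_zero, sub_eq_zero] using h

/-- The increment of the `(n + 1)`-particle component of `E` over `[r, r + h]` agrees with the term
of the Itô sum up to the product of `E r` with the part of `E h` of second order. -/
lemma increment_sub_eq (n : ℕ) (r h : ℝ≥0) :
    numProj (n + 1) (E (r + h)) - numProj (n + 1) (E r)
        - fockMul (W.toFun r) (numProj n (E r)) (wedge [η h])
      = numProj (n + 1) (fockMul (W.toFun r) (E r) (E h - (vacuum H + wedge [η h]))) := by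
  rw [map_sub, map_add, fockMul_vacuum_right (hE.mem r), hE.mul, map_sub, map_add,
    numProj_succ_fockMul_wedge, sub_sub]

/-- The errors of the Itô sum over equal steps of length `h` are pairwise orthogonal, because the
second-order part of `E h` is orthogonal to the vacuum. -/
lemma norm_sub_sum_sq_le (n : ℕ) (h : ℝ≥0) (k : ℕ) :
    numProj (n + 1) (E (k * h))
        - ∑ i ∈ Finset.range k, fockMul (W.toFun (i * h)) (numProj n (E (i * h))) (wedge [η h])
        ∈ carFibre (W.toFun (k * h)) ∧
      ‖numProj (n + 1) (E (k * h))
        - ∑ i ∈ Finset.range k, fockMul (W.toFun (i * h)) (numProj n (E (i * h))) (wedge [η h])‖ ^ 2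
        ≤ k * (Real.exp (c * (k * h)) * (Real.exp (c * h) - 1 - c * h)) := by
  induction k with
  | zero => simp [hE.apply_zero hη, numProj_vacuum]
  | succ k ih =>
    obtain ⟨ihm, ihn⟩ := ih
    set D := numProj (n + 1) (E (k * h))
        - ∑ i ∈ Finset.range k, fockMul (W.toFun (i * h)) (numProj n (E (i * h))) (wedge [η h])
      with hD
    set y := E h - (vacuum H + wedge [η h]) with hy
    set U := fockMul (W.toFun (k * h)) (E (k * h)) y with hU
    have er : ((k + 1 : ℕ) : ℝ≥0) * h = k * h + h := by push_cast; ring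
    have e : numProj (n + 1) (E ((k + 1 : ℕ) * h)) - ∑ i ∈ Finset.range (k + 1),
        fockMul (W.toFun (i * h)) (numProj n (E (i * h))) (wedge [η h])
        = D + numProj (n + 1) U := by
      rw [hU, hy, ← hE.increment_sub_eq hη, Finset.sum_range_succ, er, hD]
      abel
    have hym : y ∈ carFibre (W.toFun h) := sub_mem (hE.mem h) (hη.first_order_mem h)
    have hy0 : ⟪vacuum H, y⟫_ℂ = 0 := by
      have h1 : numProj 0 y = 0 := by
        rw [hy, map_sub, hE.numProj_zero, map_add, numProj_vacuum, if_pos rfl, numProj_wedge,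
          if_neg (by simp), add_zero, sub_self]
      have h2 : vacuum H = numProj 0 (vacuum H) := by rw [numProj_vacuum, if_pos rfl]
      rw [h2, inner_numProj_left, h1, inner_zero_right]
    have horth : ⟪D, numProj (n + 1) U⟫_ℂ = 0 := by
      have hm := numProj_mem_carFibre ihm (n + 1)
      rw [← inner_numProj_left, ← fockMul_vacuum_right hm, hU, inner_fockMul hm (hE.mem _), hy0,
        mul_zero]
    have hδ : 0 ≤ Real.exp (c * h) - 1 - c * h := by
      rw [← hE.norm_sub_first_order_sq hη]
      positivity
    have hUn : ‖numProj (n + 1) U‖ ^ 2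
        ≤ Real.exp (c * (k * h)) * (Real.exp (c * h) - 1 - c * h) := by
      calc ‖numProj (n + 1) U‖ ^ 2 ≤ ‖U‖ ^ 2 := by gcongr; exact norm_numProj_le _ _
        _ = _ := by
          rw [hU, norm_fockMul (hE.mem _), mul_pow, hE.norm_sq, hE.norm_sub_first_order_sq hη]
          push_cast
          rfl
    refine ⟨?_, ?_⟩
    · rw [e, er]
      exact add_mem (carFibre_le_add W _ _ ihm)
        (numProj_mem_carFibre (fockMul_mem_carFibre W (hE.mem _) hym) _)
    · rw [e, @norm_add_sq ℂ, horth]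
      have hexp : Real.exp (c * (k * h)) ≤ Real.exp (c * ((k + 1 : ℕ) * h)) := by
        gcongr
        simp
      have h3 := mul_le_mul_of_nonneg_right hexp hδ
      have h4 := mul_le_mul_of_nonneg_left h3 (by positivity : (0 : ℝ) ≤ (k + 1 : ℕ))
      refine le_trans ?_ h4
      simp only [map_zero, mul_zero, add_zero]
      push_cast
      linarith

lemma itoSum_eq (n : ℕ) (s : ℝ≥0) (k : ℕ) :
    itoSum W (fun r r' => wedge [η (r' - r)]) (fun r => numProj n (E r)) s k
      = ∑ i ∈ Finset.range k, fockMul (W.toFun (i * (s / k))) (numProj n (E (i * (s / k))))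
          (wedge [η (s / k)]) := by
  refine Finset.sum_congr rfl fun i _ => ?_
  have e : ((i : ℝ≥0) + 1) * s / k - i * s / k = s / k := by
    rw [add_mul, one_mul, add_div, add_tsub_cancel_left]
  simp only [e]
  simp only [mul_div_assoc]
  rw [fockMul_vacuum_right (wedge_singleton_mem_carFibre (hη.adjoint_eq_zero _))]

lemma tendsto_itoSum (n : ℕ) (s : ℝ≥0) :
    Tendsto (itoSum W (fun r r' => wedge [η (r' - r)]) (fun r => numProj n (E r)) s) atTop
      (𝓝 (numProj (n + 1) (E s))) := by
  rw [tendsto_iff_norm_sub_tendsto_zero]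
  set a : ℝ := c * s with ha
  have ha0 : 0 ≤ a := by positivity
  have hlim : Tendsto (fun k : ℕ => √(Real.exp a * a ^ 2 / (k : ℝ))) atTop (𝓝 0) := by
    simpa using (tendsto_const_div_atTop_nhds_zero_nat (Real.exp a * a ^ 2)).sqrt
  refine squeeze_zero' (Eventually.of_forall fun _ => norm_nonneg _) ?_ hlim
  have hev : ∀ᶠ k : ℕ in atTop, a / (k : ℝ) < 1 :=
    (tendsto_const_div_atTop_nhds_zero_nat a).eventually_lt_const one_pos
  filter_upwards [hev, eventually_ge_atTop 1] with k hk hk1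
  have hk0 : (0 : ℝ) < k := by exact_mod_cast hk1
  have hks : (k : ℝ≥0) * (s / k) = s := mul_div_cancel₀ _ (by positivity)
  have hks' : (c : ℝ) * ((k : ℝ) * ((s / k : ℝ≥0) : ℝ)) = a := by
    rw [ha, ← hks]
    push_cast
    field_simp
  have hd : (c : ℝ) * ((s / k : ℝ≥0) : ℝ) = a / k := by
    rw [ha]
    push_cast
    ring
  refine Real.le_sqrt_of_sq_le ?_
  have h1 := (hE.norm_sub_sum_sq_le hη n (s / k) k).2
  rw [hks, ← hE.itoSum_eq hη, hks', hd, norm_sub_rev] at h1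
  refine h1.trans ?_
  have h2 : Real.exp (a / k) - 1 - a / k ≤ (a / k) ^ 2 := by
    refine (le_abs_self _).trans (Real.abs_exp_sub_one_sub_id_le ?_)
    rw [abs_of_nonneg (by positivity)]
    exact hk.le
  calc (k : ℝ) * (Real.exp a * (Real.exp (a / k) - 1 - a / k))
      ≤ k * (Real.exp a * (a / k) ^ 2) := by gcongr
    _ = Real.exp a * a ^ 2 / k := by field_simp

lemma isExponential (t : ℝ≥0) : IsExponential W t (wedge [η t]) (E t) := by
  have hvac : ∀ s, ⟪vacuum H, wedge [η s]⟫_ℂ = 0 := fun s => by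
    rw [vacuum, inner_wedge, wedgeKernel_of_length_ne (by simp)]
  have hmem : ∀ s, wedge [η s] ∈ carFibre (W.toFun s) := fun s =>
    wedge_singleton_mem_carFibre (hη.adjoint_eq_zero s)
  have hdec : ∀ r s, r ≤ s → wedge [η s] = fockMul (W.toFun r) (wedge [η r]) (vacuum H)
      + fockMul (W.toFun r) (vacuum H) (wedge [η (s - r)]) := by
    intro r s hrs
    rw [fockMul_vacuum_right (hmem r), fockMul_vacuum_wedge, ← wedge_add, ← hη.add,
      add_tsub_cancel_of_le hrs]
  refine ⟨fun s => wedge [η s], fun r s => wedge [η (s - r)], fun n s => numProj n (E s),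
    ⟨fun s _ => ⟨hmem s, hvac s, fun r hr => ?_⟩, fun r s hr _ => ⟨hmem _, hdec r s hr⟩⟩, rfl,
    fun s _ => hE.numProj_zero s, fun s _ => hE.numProj_one s,
    fun n _ s _ => hE.tendsto_itoSum hη n s, hasSum_numProj _⟩
  exact ⟨_, hmem r, _, hmem _, hvac r, hvac _, hdec r s hr⟩

/-- The exponential of the cocycle at time `t` is the unit `E`. -/
lemma oneParamExp_eq (t : ℝ≥0) : oneParamExp W t (wedge [η t]) = E t := by
  have h : ∃ z, IsExponential W t (wedge [η t]) z := ⟨_, hE.isExponential hη t⟩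
  rw [oneParamExp, dif_pos h]
  exact h.choose_spec.unique (hE.isExponential hη t)

end IsExponentialUnit

end ItoIntegral

namespace Yu

variable {d : ℕ} {P : ProperCone ℝ (Euc d)}

/-! ### Order and translations in the space of closed sets -/

lemma exists_pos_add_smul_mem {x : Euc d} {U : Set (Euc d)} (hU : U ∈ 𝓝 x) (v : Euc d) :
    ∃ t : ℝ, 0 < t ∧ x + t • v ∈ U := by
  have hc : Continuous fun t : ℝ => x + t • v := by fun_prop
  have h1 : Tendsto (fun t : ℝ => x + t • v) (𝓝[>] 0) (𝓝 x) := by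
    have := (hc.tendsto 0).mono_left (nhdsWithin_le_nhds (s := Set.Ioi (0 : ℝ)))
    simpa using this
  obtain ⟨t, ht, h0⟩ := ((h1.eventually_mem hU).and self_mem_nhdsWithin).exists
  exact ⟨t, h0, ht⟩

lemma smul_mem_interior {v : Euc d} (hv : v ∈ interior (P : Set (Euc d))) {t : ℝ} (ht : 0 < t) :
    t • v ∈ interior (P : Set (Euc d)) := by
  have h1 : t • v ∈ t • interior (P : Set (Euc d)) := Set.smul_mem_smul_set hv
  rw [← interior_smul₀ ht.ne'] at h1
  refine interior_mono ?_ h1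
  rintro _ ⟨p, hp, rfl⟩
  exact P.smul_mem hp ht.le

/-- If `a` is in the interior of `A`, then `A` meets the open set `a + int P`, and every set of `Y_u`
which meets it contains `a`. -/
lemma XuAdd_mem_nhds (hP : (P : Set (Euc d)) - (P : Set (Euc d)) = Set.univ) {A : Yu P}
    {a : Euc d} (ha : a ∈ interior A.toSet) : XuAdd P a ∈ 𝓝 A := by
  obtain ⟨v, hv⟩ := interior_nonempty hP
  obtain ⟨t, ht, hmem⟩ := exists_pos_add_smul_mem (isOpen_interior.mem_nhds ha) v
  have hU : IsOpen ((fun y : Euc d => y - a) ⁻¹' interior (P : Set (Euc d))) :=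
    isOpen_interior.preimage (by fun_prop)
  refine mem_of_superset ((isOpen_hit hU).mem_nhds ⟨a + t • v, interior_subset hmem, ?_⟩) ?_
  · simpa using smul_mem_interior hv ht
  · rintro B ⟨y, hy, hyU⟩
    have := B.sub_mem hy (interior_subset hyU)
    rwa [sub_sub_cancel, ← mem_XuAdd_iff] at this

lemma compl_XuAdd_mem_nhds {A : Yu P} {a : Euc d} (ha : a ∉ A.toSet) : (XuAdd P a)ᶜ ∈ 𝓝 A := by
  refine mem_of_superset ((isOpen_miss (isCompact_singleton (x := a))).mem_nhds ?_) ?_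
  · simpa [Set.inter_singleton_eq_empty] using ha
  · intro B hB
    rw [Set.mem_compl_iff, mem_XuAdd_iff]
    simpa [Set.inter_singleton_eq_empty] using hB

/-- The sets in `Y_u` are the closures of their interiors. -/
lemma subset_of_interior_subset (hP : (P : Set (Euc d)) - (P : Set (Euc d)) = Set.univ)
    {A B : Yu P} (h : interior A.toSet ⊆ B.toSet) : A.toSet ⊆ B.toSet := by
  intro x hx
  by_contra hxB
  obtain ⟨v, hv⟩ := interior_nonempty hP
  obtain ⟨t, ht, hmem⟩ :=
    exists_pos_add_smul_mem (B.isClosed_toSet.isOpen_compl.mem_nhds hxB) (-v)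
  refine hmem (h ?_)
  have hU : IsOpen ((fun y : Euc d => x - y) ⁻¹' interior (P : Set (Euc d))) :=
    isOpen_interior.preimage (by fun_prop)
  refine interior_maximal ?_ hU ?_
  · intro y hy
    have := A.sub_mem hx (interior_subset hy)
    rwa [sub_sub_cancel] at this
  · simpa using smul_mem_interior hv ht

section Support

variable (μ : Measure (Yu P)) [VAddInvariantMeasure (Euc d) (Yu P) μ]

lemma preimage_XuAdd_add (z a : Euc d) :
    (fun A : Yu P => z +ᵥ A) ⁻¹' XuAdd P (a + z) = XuAdd P a := by
  ext A
  rw [Set.mem_preimage, mem_XuAdd_iff, mem_XuAdd_iff, mem_vadd, add_sub_cancel_right]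

lemma measure_XuAdd_diff_add (z a b : Euc d) :
    μ (XuAdd P (a + z) \ XuAdd P (b + z)) = μ (XuAdd P a \ XuAdd P b) := by
  rw [← VAddInvariantMeasure.measure_preimage_vadd z
    ((measurableSet_XuAdd (a + z)).diff (measurableSet_XuAdd (b + z))), Set.preimage_sdiff,
    preimage_XuAdd_add, preimage_XuAdd_add]

lemma vadd_mem_support {A : Yu P} (hA : A ∈ μ.support) (x : Euc d) : x +ᵥ A ∈ μ.support := by
  rw [Measure.mem_support_iff_forall] at hA ⊢
  intro U hU
  obtain ⟨V, hVU, hV, hAV⟩ := mem_nhds_iff.mp hU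
  refine lt_of_lt_of_le ?_ (measure_mono hVU)
  rw [← VAddInvariantMeasure.measure_preimage_vadd x hV.measurableSet]
  exact hA _ ((hV.preimage (continuous_vadd' x)).mem_nhds hAV)

/-- If `X_u + a` and `X_u + b` are nested up to null sets for all `a` and `b` in `P`, then the
support of `μ` is totally ordered by inclusion. -/
lemma support_total (hP : (P : Set (Euc d)) - (P : Set (Euc d)) = Set.univ)
    (h : ∀ a b : P, μ (XuAdd P (a : Euc d) \ XuAdd P (b : Euc d)) = 0 ∨
      μ (XuAdd P (b : Euc d) \ XuAdd P (a : Euc d)) = 0)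
    {A B : Yu P} (hA : A ∈ μ.support) (hB : B ∈ μ.support) :
    A.toSet ⊆ B.toSet ∨ B.toSet ⊆ A.toSet := by
  by_contra hcon
  rw [not_or] at hcon
  have hAB := mt (subset_of_interior_subset hP) hcon.1
  have hBA := mt (subset_of_interior_subset hP) hcon.2
  obtain ⟨p, hpA, hpB⟩ := Set.not_subset.mp hAB
  obtain ⟨q, hqB, hqA⟩ := Set.not_subset.mp hBA
  obtain ⟨a, ha, b, hb, hab⟩ : p - q ∈ (P : Set (Euc d)) - (P : Set (Euc d)) := hP ▸ Set.mem_univ _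
  have hab : a - b = p - q := hab
  -- `p - a = q - b`, and both pairs differ by this translation
  have hp : p = a + (p - a) := by abel
  have hq : q = b + (p - a) := by
    have : p = a - b + q := by rw [hab]; abel
    rw [this]; abel
  have h1 : 0 < μ (XuAdd P p \ XuAdd P q) :=
    (Measure.mem_support_iff_forall A).mp hA _
      (inter_mem (XuAdd_mem_nhds hP hpA) (compl_XuAdd_mem_nhds hqA))
  have h2 : 0 < μ (XuAdd P q \ XuAdd P p) :=
    (Measure.mem_support_iff_forall B).mp hB _
      (inter_mem (XuAdd_mem_nhds hP hqB) (compl_XuAdd_mem_nhds hpB))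
  have e1 := measure_XuAdd_diff_add μ (p - a) a b
  have e2 := measure_XuAdd_diff_add μ (p - a) b a
  rw [← hp, ← hq] at e1 e2
  rw [e1] at h1
  rw [e2] at h2
  rcases h ⟨a, ha⟩ ⟨b, hb⟩ with h0 | h0
  · exact h1.ne' h0
  · exact h2.ne' h0

end Support

/-! ### Half-spaces -/

section HalfSpaces

variable {lam : Euc d}

lemma mem_halfSpaces_iff (hl : ‖lam‖ = 1) {A : Yu P} :
    A ∈ halfSpaces P lam ↔ ∃ c : ℝ, ∀ x, x ∈ A.toSet ↔ ⟪lam, x⟫_ℝ ≤ c := by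
  have key : ∀ (c : ℝ) (x : Euc d), x ∈ {x : Euc d | ⟪lam, x⟫_ℝ ≤ 0} + {c • lam} ↔
      ⟪lam, x⟫_ℝ ≤ c := by
    intro c x
    rw [Set.add_singleton]
    constructor
    · rintro ⟨y, hy, rfl⟩
      have hy : ⟪lam, y⟫_ℝ ≤ 0 := hy
      rw [inner_add_right, real_inner_smul_right, real_inner_self_eq_norm_sq, hl]
      linarith
    · intro hx
      refine ⟨x - c • lam, ?_, by simp⟩
      change ⟪lam, x - c • lam⟫_ℝ ≤ 0
      rw [inner_sub_right, real_inner_smul_right, real_inner_self_eq_norm_sq, hl]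
      linarith
  constructor
  · rintro ⟨c, hc⟩
    exact ⟨c, fun x => by rw [hc, key]⟩
  · rintro ⟨c, hc⟩
    exact ⟨c, Set.ext fun x => by rw [hc, key]⟩

/-- A closed set which contains all points below any of its points, with respect to the linear
functional `lam`, is a half-space. -/
lemma mem_halfSpaces_of_forall (hl : ‖lam‖ = 1) {A : Yu P}
    (h : ∀ y ∈ A.toSet, ∀ x, ⟪lam, x⟫_ℝ < ⟪lam, y⟫_ℝ → x ∈ A.toSet) : A ∈ halfSpaces P lam := by
  rw [mem_halfSpaces_iff hl]
  obtain ⟨x₁, hx₁⟩ := A.exists_notMem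
  obtain ⟨y₁, hy₁⟩ := A.exists_mem
  have hbdd : BddAbove ((fun y => ⟪lam, y⟫_ℝ) '' A.toSet) := by
    refine ⟨⟪lam, x₁⟫_ℝ, ?_⟩
    rintro _ ⟨y, hy, rfl⟩
    by_contra hlt
    exact hx₁ (h y hy x₁ (not_le.mp hlt))
  have hne : ((fun y => ⟪lam, y⟫_ℝ) '' A.toSet).Nonempty := ⟨_, y₁, hy₁, rfl⟩
  refine ⟨sSup ((fun y => ⟪lam, y⟫_ℝ) '' A.toSet), fun x => ⟨fun hx => ?_, fun hx => ?_⟩⟩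
  · exact le_csSup hbdd ⟨x, hx, rfl⟩
  · by_contra hxA
    obtain ⟨t, ht, hmem⟩ :=
      exists_pos_add_smul_mem (A.isClosed_toSet.isOpen_compl.mem_nhds hxA) (-lam)
    have hlt : ⟪lam, x + t • -lam⟫_ℝ < sSup ((fun y => ⟪lam, y⟫_ℝ) '' A.toSet) := by
      rw [inner_add_right, real_inner_smul_right, inner_neg_right, real_inner_self_eq_norm_sq, hl]
      linarith
    obtain ⟨_, ⟨y, hy, rfl⟩, hlty⟩ := exists_lt_of_lt_csSup hne hlt
    exact hmem (h y hy _ hlty)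

variable (P) in
lemma exists_level (A : Yu P) (hl : ‖lam‖ = 1) (hA : A ∈ halfSpaces P lam) (m : ℝ) :
    ∃ z : Euc d, ∀ x, x ∈ (z +ᵥ A).toSet ↔ ⟪lam, x⟫_ℝ ≤ m := by
  obtain ⟨c, hc⟩ := (mem_halfSpaces_iff hl).mp hA
  refine ⟨(m - c) • lam, fun x => ?_⟩
  rw [mem_vadd, hc, inner_sub_right, real_inner_smul_right, real_inner_self_eq_norm_sq, hl]
  constructor <;> intro h <;> linarith

end HalfSpaces

section Stabiliser

/-- The closed set of translations `x` with `A - x ⊆ A`. -/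
def downTranslations (A : Yu P) : Set (Euc d) := {x | ∀ y ∈ A.toSet, y - x ∈ A.toSet}

lemma isClosed_downTranslations (A : Yu P) : IsClosed A.downTranslations := by
  have : A.downTranslations = ⋂ y ∈ A.toSet, (fun x => y - x) ⁻¹' A.toSet := by
    ext x
    simp [downTranslations]
  rw [this]
  exact isClosed_biInter fun y _ => A.isClosed_toSet.preimage (by fun_prop)

lemma zero_mem_downTranslations (A : Yu P) : (0 : Euc d) ∈ A.downTranslations :=
  fun y hy => by rwa [sub_zero]

lemma add_mem_downTranslations {A : Yu P} {x y : Euc d} (hx : x ∈ A.downTranslations)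
    (hy : y ∈ A.downTranslations) : x + y ∈ A.downTranslations := by
  intro z hz
  rw [← sub_sub]
  exact hy _ (hx z hz)

lemma nsmul_mem_downTranslations {A : Yu P} {x : Euc d} (hx : x ∈ A.downTranslations) (n : ℕ) :
    n • x ∈ A.downTranslations := by
  induction n with
  | zero => simpa using A.zero_mem_downTranslations
  | succ n ih => rw [succ_nsmul]; exact add_mem_downTranslations ih hx

/-- If `A` is comparable with all its translates, then the translations `x` with `A - x ⊆ A` form a
cone: if `x / n` is not one of them, then `-x / n` is, hence so is `x / n = x + (n - 1) (-x / n)`. -/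
lemma smul_mem_downTranslations {A : Yu P}
    (htot : ∀ x, x ∈ A.downTranslations ∨ -x ∈ A.downTranslations) {x : Euc d}
    (hx : x ∈ A.downTranslations) {r : ℝ} (hr : 0 ≤ r) : r • x ∈ A.downTranslations := by
  have hdiv : ∀ n : ℕ, ((n + 1 : ℕ) : ℝ)⁻¹ • x ∈ A.downTranslations := by
    intro n
    rcases htot (((n + 1 : ℕ) : ℝ)⁻¹ • x) with h | h
    · exact h
    · have h1 := add_mem_downTranslations hx (nsmul_mem_downTranslations h n)
      convert h1 using 1
      have hn : ((n : ℝ) + 1) ≠ 0 := by positivity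
      rw [← Nat.cast_smul_eq_nsmul ℝ n, smul_neg, smul_smul, ← sub_eq_add_neg]
      nth_rewrite 2 [← one_smul ℝ x]
      rw [← sub_smul]
      congr 1
      push_cast
      field_simp
      ring
  have hlim : Tendsto (fun n : ℕ => ((⌊r * ((n + 1 : ℕ) : ℝ)⌋₊ : ℝ) / ((n + 1 : ℕ) : ℝ)) • x) atTop
      (𝓝 (r • x)) := by
    have h1 := (tendsto_nat_floor_mul_div_atTop hr).comp
      (tendsto_natCast_atTop_atTop.comp (tendsto_add_atTop_nat 1))
    exact h1.smul_const x
  refine A.isClosed_downTranslations.mem_of_tendsto hlim (Eventually.of_forall fun n => ?_)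
  have := nsmul_mem_downTranslations (hdiv n) ⌊r * ((n + 1 : ℕ) : ℝ)⌋₊
  rwa [← Nat.cast_smul_eq_nsmul ℝ, smul_smul, ← div_eq_mul_inv] at this

/-- If `A` is comparable with all its translates, then for some `lam` in the dual sphere of `P`
every `x` with `⟪lam, x⟫ > 0` translates `A` into itself. -/
lemma exists_dualSphere_of_total {A : Yu P}
    (htot : ∀ x, x ∈ A.downTranslations ∨ -x ∈ A.downTranslations) :
    ∃ lam ∈ dualSphere P, ∀ x, 0 < ⟪lam, x⟫_ℝ → x ∈ A.downTranslations := by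
  let G : ProperCone ℝ (Euc d) :=
    { carrier := A.downTranslations
      add_mem' := add_mem_downTranslations
      zero_mem' := A.zero_mem_downTranslations
      smul_mem' := fun r _ hx => smul_mem_downTranslations htot hx r.2
      isClosed' := A.isClosed_downTranslations }
  have hG : ∀ x, x ∈ G ↔ x ∈ A.downTranslations := fun _ => Iff.rfl
  obtain ⟨x₁, hx₁⟩ := A.exists_notMem
  obtain ⟨y₁, hy₁⟩ := A.exists_mem
  have hx₀ : y₁ - x₁ ∉ G := by
    intro h
    have := h y₁ hy₁
    rw [sub_sub_cancel] at this
    exact hx₁ this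
  obtain ⟨w, hw, hw₀⟩ := G.hyperplane_separation' hx₀
  have hwne : w ≠ 0 := by
    rintro rfl
    simp at hw₀
  have hwpos : 0 < ‖w‖ := norm_pos_iff.mpr hwne
  have hinner : ∀ x, ⟪‖w‖⁻¹ • w, x⟫_ℝ = ‖w‖⁻¹ * ⟪x, w⟫_ℝ := fun x => by
    rw [real_inner_smul_left, real_inner_comm]
  refine ⟨‖w‖⁻¹ • w, ⟨fun p hp => ?_, ?_⟩, fun x hx => ?_⟩
  · rw [hinner]
    exact mul_nonneg (by positivity) (hw p ((hG p).mpr fun y hy => A.sub_mem hy hp))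
  · rw [norm_smul, norm_inv, norm_norm, inv_mul_cancel₀ hwpos.ne']
  · rcases htot x with h | h
    · exact h
    · exfalso
      have h1 := hw _ ((hG _).mpr h)
      rw [inner_neg_left] at h1
      rw [hinner] at hx
      have h2 := pos_of_mul_pos_right hx (by positivity)
      linarith

end Stabiliser

/-- A measure whose support is totally ordered by inclusion is supported by the translates of a
half-space. -/
lemma exists_support_eq_halfSpaces (μ : Measure (Yu P)) [μ.Regular]
    [VAddInvariantMeasure (Euc d) (Yu P) μ] (hμ : μ ≠ 0)
    (htot : ∀ A ∈ μ.support, ∀ B ∈ μ.support, A.toSet ⊆ B.toSet ∨ B.toSet ⊆ A.toSet) :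
    ∃ lam ∈ dualSphere P, μ.support = halfSpaces P lam := by
  obtain ⟨A, hA⟩ : μ.support.Nonempty := by
    rw [Set.nonempty_iff_ne_empty]
    intro h
    refine hμ (Measure.measure_univ_eq_zero.mp ?_)
    rw [← Set.compl_empty, ← h]
    exact Measure.measure_compl_support_of_regular
  have htrans : ∀ x, x ∈ A.downTranslations ∨ -x ∈ A.downTranslations := by
    intro x
    rcases htot A hA _ (vadd_mem_support μ hA x) with h | h
    · exact Or.inl fun y hy => h hy
    · refine Or.inr fun y hy => h ?_
      rw [mem_vadd, sub_neg_eq_add, add_sub_cancel_right]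
      exact hy
  obtain ⟨lam, hlam, hpos⟩ := exists_dualSphere_of_total htrans
  have hl : ‖lam‖ = 1 := hlam.2
  have hAh : A ∈ halfSpaces P lam := by
    refine mem_halfSpaces_of_forall hl fun y hy x hxy => ?_
    have := hpos (y - x) (by rw [inner_sub_right]; linarith) y hy
    rwa [sub_sub_cancel] at this
  refine ⟨lam, hlam, Set.Subset.antisymm (fun B hB => ?_) (fun B hB => ?_)⟩
  · refine mem_halfSpaces_of_forall hl fun y hy x hxy => ?_
    -- compare `B` with a translate of `A` whose boundary separates `x` from `y`
    obtain ⟨z, hz⟩ := exists_level P A hl hAh ((⟪lam, x⟫_ℝ + ⟪lam, y⟫_ℝ) / 2)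
    rcases htot _ (vadd_mem_support μ hA z) B hB with h | h
    · exact h ((hz x).mpr (by linarith))
    · have := (hz y).mp (h hy)
      linarith
  · obtain ⟨c, hc⟩ := (mem_halfSpaces_iff hl).mp hB
    obtain ⟨z, hz⟩ := exists_level P A hl hAh c
    have : B = z +ᵥ A := ext (Set.ext fun x => by rw [hc, hz])
    rw [this]
    exact vadd_mem_support μ hA z

end Yu

namespace Yu

variable {d : ℕ} {P : ProperCone ℝ (Euc d)} (μ : Measure (Yu P))
  [VAddInvariantMeasure (Euc d) (Yu P) μ]

/-! ### Indicator functions and the isometries `V_a` -/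

lemma adjoint_shiftIsometry_indicator (a : P) {T : Set (Yu P)} (hT : MeasurableSet T)
    (hfin : μ.restrict (Xu P) T ≠ ⊤) (hdisj : ∀ A ∈ T, A ∉ XuAdd P (a : Euc d)) :
    (shiftIsometry μ a).toContinuousLinearMap.adjoint (indicatorConstLp 2 hT hfin (1 : ℂ)) = 0 := by
  refine ext_inner_right ℂ fun w => ?_
  rw [ContinuousLinearMap.adjoint_inner_left, inner_zero_left]
  change ⟪indicatorConstLp 2 hT hfin (1 : ℂ), shiftIsometry μ a w⟫_ℂ = 0
  rw [L2.inner_indicatorConstLp_one]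
  refine (setIntegral_congr_ae (g := fun _ => (0 : ℂ)) hT ?_).trans (by simp)
  filter_upwards [coeFn_shiftIsometry μ a w] with A hA hAT
  rw [hA, shiftFun_eq, Set.indicator_of_notMem (hdisj A hAT)]

lemma measurableSet_preimage_vadd (a : Euc d) {S : Set (Yu P)} (hS : MeasurableSet S) :
    MeasurableSet ((fun A : Yu P => a +ᵥ A) ⁻¹' S) :=
  hS.preimage (measurable_const_vadd a)

lemma shiftIsometry_indicator (a : P) {S : Set (Yu P)} (hS : MeasurableSet S)
    (hfin : μ.restrict (Xu P) S ≠ ⊤) (hsub : S ⊆ XuAdd P (a : Euc d))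
    (hfin' : μ.restrict (Xu P) ((fun A : Yu P => (a : Euc d) +ᵥ A) ⁻¹' S) ≠ ⊤) :
    shiftIsometry μ a (indicatorConstLp 2 (measurableSet_preimage_vadd (a : Euc d) hS) hfin'
      (1 : ℂ)) = indicatorConstLp 2 hS hfin (1 : ℂ) := by
  classical
  refine Lp.ext ((coeFn_shiftIsometry μ a _).trans
    ((shiftFun_congr μ a indicatorConstLp_coeFn).trans
      (EventuallyEq.trans ?_ indicatorConstLp_coeFn.symm)))
  refine ae_of_all _ fun A => ?_
  have e : (a : Euc d) +ᵥ ((-(a : Euc d)) +ᵥ A) = A := by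
    rw [vadd_vadd', add_neg_cancel, zero_vadd']
  rw [shiftFun_eq]
  simp only [Set.indicator_apply, Function.comp_apply, Set.mem_preimage, e]
  split_ifs with h1 h2 h3
  · rfl
  · rfl
  · exact absurd (hsub h3) h1
  · rfl

/-! ### The cocycle `a ↦ 1_{X_u \ (X_u + a)}` -/

section Cocycle

variable [IsFiniteMeasureOnCompacts μ]
  (hP : (P : Set (Euc d)) - (P : Set (Euc d)) = Set.univ)

lemma coeFn_cocycle (a : P) : cocycle hP μ a =ᵐ[μ.restrict (Xu P)]
    (Xu P \ XuAdd P (a : Euc d)).indicator fun _ => (1 : ℂ) :=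
  indicatorConstLp_coeFn

lemma adjoint_cocycle (a : P) :
    (shiftIsometry μ a).toContinuousLinearMap.adjoint (cocycle hP μ a) = 0 :=
  adjoint_shiftIsometry_indicator μ a _ _ fun _ hA => hA.2

lemma cocycle_add (a b : P) :
    cocycle hP μ (a + b) = cocycle hP μ a + shiftIsometry μ a (cocycle hP μ b) := by
  classical
  refine Lp.ext ((coeFn_cocycle μ hP (a + b)).trans
    (EventuallyEq.trans ?_ (Lp.coeFn_add _ _).symm))
  have h1 := coeFn_cocycle μ hP a
  have h2 := (coeFn_shiftIsometry μ a (cocycle hP μ b)).trans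
    (shiftFun_congr μ a (coeFn_cocycle μ hP b))
  filter_upwards [h1, h2] with A hA1 hA2
  rw [Pi.add_apply, hA1, hA2, shiftFun_eq]
  have e1 : A ∈ XuAdd P (a : Euc d) ↔ (-(a : Euc d)) +ᵥ A ∈ Xu P := mem_XuAdd
  have e2 : (-(a : Euc d)) +ᵥ A ∈ XuAdd P (b : Euc d) ↔ A ∈ XuAdd P ((a + b : P) : Euc d) := by
    rw [mem_XuAdd_iff, mem_XuAdd_iff, mem_vadd, sub_neg_eq_add, add_comm]
    rfl
  have e3 : A ∈ XuAdd P ((a + b : P) : Euc d) → A ∈ XuAdd P (a : Euc d) := fun h => by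
    rw [← e2] at h
    exact e1.mpr (XuAdd_subset b h)
  have e4 : A ∈ XuAdd P (a : Euc d) → A ∈ Xu P := fun h => XuAdd_subset a h
  simp only [Set.indicator_apply, Function.comp_apply, Set.mem_sdiff, e2, ← e1]
  by_cases g1 : A ∈ XuAdd P (a : Euc d)
  · simp [g1, e4 g1]
  · have g2 := mt e3 g1
    simp only [g1, g2, not_false_iff, and_true, if_false, add_zero]

end Cocycle

/-! ### Commuting exponentials make the support totally ordered -/

section Unit

variable [IsFiniteMeasureOnCompacts μ]
  (hP : (P : Set (Euc d)) - (P : Set (Euc d)) = Set.univ)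

/-- The one-particle component of a nonzero exponential. -/
lemma inner_wedge_rayExp {a : P} {f : Lp ℂ 2 (μ.restrict (Xu P))}
    (hne : rayExp (shiftSemigroup μ) a f ≠ 0) (g : Lp ℂ 2 (μ.restrict (Xu P))) :
    ⟪wedge [g], rayExp (shiftSemigroup μ) a f⟫_ℂ = ⟪g, f⟫_ℂ := by
  have h : ∃ z, IsExponential (ray (shiftSemigroup μ) a) 1 (wedge [f]) z := by
    by_contra hn
    exact hne (dif_neg hn)
  have e : numProj 1 (rayExp (shiftSemigroup μ) a f) = wedge [f] := by
    rw [rayExp, oneParamExp, dif_pos h]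
    exact h.choose_spec.numProj_one
  have eg : wedge [g] = numProj 1 (wedge [g]) := by rw [numProj_wedge, if_pos (by simp)]
  rw [eg, inner_numProj_left, e, inner_wedge_singleton]

include hP in
lemma measure_XuAdd_diff_lt_top (a b : P) :
    μ (XuAdd P (a : Euc d) \ XuAdd P (b : Euc d)) < ⊤ :=
  (measure_mono (Set.sdiff_subset_sdiff_left (XuAdd_subset a))).trans_lt (measure_diff_lt_top hP μ b)

/-- The indicator function of `(X_u + a) \ (X_u + b)`. -/
def diffIndicator (a b : P) : Lp ℂ 2 (μ.restrict (Xu P)) :=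
  indicatorConstLp 2 (s := XuAdd P (a : Euc d) \ XuAdd P (b : Euc d))
    ((measurableSet_XuAdd _).diff (measurableSet_XuAdd _))
    ((Measure.restrict_apply_le _ _).trans_lt (measure_XuAdd_diff_lt_top μ hP a b)).ne (1 : ℂ)

lemma inner_indicator_of_subset {S T : Set (Yu P)} (hS : MeasurableSet S) (hT : MeasurableSet T)
    (hSf : μ.restrict (Xu P) S ≠ ⊤) (hTf : μ.restrict (Xu P) T ≠ ⊤) (hST : S ⊆ T)
    (hSX : S ⊆ Xu P) :
    ⟪indicatorConstLp 2 hS hSf (1 : ℂ), indicatorConstLp 2 hT hTf (1 : ℂ)⟫_ℂ = (μ.real S : ℂ) := by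
  rw [L2.inner_indicatorConstLp_one_indicatorConstLp_one hS hT hSf hTf, Set.inter_eq_left.mpr hST,
    Measure.real, Measure.restrict_apply hS, Set.inter_eq_left.mpr hSX]
  rfl

/-- The wedge product of the indicator functions of `(X_u + a) \ (X_u + b)` and
`(X_u + b) \ (X_u + a)` factorises in the product `E(a) × E(b) → E(a + b)`. -/
lemma inner_wedge_diffIndicator
    (h : IsUnitOf (shiftSemigroup μ)
      (fun a : P => rayExp (shiftSemigroup μ) a (cocycle hP μ a))) (a b : P) :
    ⟪wedge [diffIndicator μ hP a b, diffIndicator μ hP b a],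
        rayExp (shiftSemigroup μ) (a + b) (cocycle hP μ (a + b))⟫_ℂ
      = (μ.real (XuAdd P (b : Euc d) \ XuAdd P (a : Euc d)) : ℂ)
        * (μ.real (XuAdd P (a : Euc d) \ XuAdd P (b : Euc d)) : ℂ) := by
  set S := XuAdd P (a : Euc d) \ XuAdd P (b : Euc d) with hS
  have hSm : MeasurableSet S := (measurableSet_XuAdd _).diff (measurableSet_XuAdd _)
  set S' := (fun A : Yu P => (a : Euc d) +ᵥ A) ⁻¹' S with hS'
  have hS'm : MeasurableSet S' := measurableSet_preimage_vadd _ hSm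
  have hμS' : μ S' = μ S := VAddInvariantMeasure.measure_preimage_vadd _ hSm
  have hfin' : μ.restrict (Xu P) S' ≠ ⊤ :=
    ((Measure.restrict_apply_le _ _).trans_lt
      (hμS' ▸ measure_XuAdd_diff_lt_top μ hP a b)).ne
  have hS'X : S' ⊆ Xu P := by
    intro A hA
    have h1 : (a : Euc d) +ᵥ A ∈ XuAdd P (a : Euc d) := hA.1
    rw [mem_XuAdd, vadd_vadd', neg_add_cancel, zero_vadd'] at h1
    exact h1
  have hS'b : S' ⊆ Xu P \ XuAdd P (b : Euc d) := by
    refine fun A hA => ⟨hS'X hA, fun hb => hA.2 ?_⟩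
    rw [mem_XuAdd_iff] at hb ⊢
    rw [mem_vadd]
    exact A.sub_mem hb a.2
  have hshift : shiftIsometry μ a (indicatorConstLp 2 hS'm hfin' (1 : ℂ))
      = diffIndicator μ hP a b :=
    shiftIsometry_indicator μ a hSm _ Set.sdiff_subset hfin'
  have hadj : (shiftIsometry μ a).toContinuousLinearMap.adjoint (diffIndicator μ hP b a) = 0 :=
    adjoint_shiftIsometry_indicator μ a _ _ fun _ hA => hA.2
  have hw : wedge [diffIndicator μ hP a b, diffIndicator μ hP b a]
      = fockMul (shiftIsometry μ a) (wedge [diffIndicator μ hP b a])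
        (wedge [indicatorConstLp 2 hS'm hfin' (1 : ℂ)]) := by
    rw [fockMul_wedge _ _ _ (by simpa using hadj), ← hshift]
    rfl
  have hb : ⟪diffIndicator μ hP b a, cocycle hP μ a⟫_ℂ
      = (μ.real (XuAdd P (b : Euc d) \ XuAdd P (a : Euc d)) : ℂ) := by
    have hsub : XuAdd P (b : Euc d) \ XuAdd P (a : Euc d) ⊆ Xu P \ XuAdd P (a : Euc d) :=
      Set.sdiff_subset_sdiff_left (XuAdd_subset b)
    exact inner_indicator_of_subset μ _ _ _ _ hsub (hsub.trans Set.sdiff_subset)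
  have ha : ⟪indicatorConstLp 2 hS'm hfin' (1 : ℂ), cocycle hP μ b⟫_ℂ = (μ.real S : ℂ) := by
    rw [Measure.real, ← hμS']
    exact inner_indicator_of_subset μ hS'm _ _ _ hS'b hS'X
  rw [hw, ← h.mul a b]
  change ⟪fockMul (shiftIsometry μ a) _ _, fockMul (shiftIsometry μ a) _ _⟫_ℂ = _
  rw [inner_fockMul (wedge_singleton_mem_carFibre hadj) (h.mem_fibre a),
    inner_wedge_rayExp μ (h.ne_zero a), inner_wedge_rayExp μ (h.ne_zero b), ha, hb]

/-- Exchanging `a` and `b` changes the sign of the wedge product of the two indicator functions,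
but not its inner product with the unit. -/
lemma measure_diff_eq_zero_of_isUnitOf
    (h : IsUnitOf (shiftSemigroup μ)
      (fun a : P => rayExp (shiftSemigroup μ) a (cocycle hP μ a))) (a b : P) :
    μ (XuAdd P (a : Euc d) \ XuAdd P (b : Euc d)) = 0 ∨
      μ (XuAdd P (b : Euc d) \ XuAdd P (a : Euc d)) = 0 := by
  have h1 := inner_wedge_diffIndicator μ hP h a b
  have h2 := inner_wedge_diffIndicator μ hP h b a
  rw [wedge_pair_swap, inner_neg_left, add_comm a b, h2, mul_comm, neg_eq_iff_add_eq_zero,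
    ← two_mul] at h1
  have h3 := (mul_eq_zero.mp h1).resolve_left two_ne_zero
  have hfin : ∀ a b : P, μ (XuAdd P (a : Euc d) \ XuAdd P (b : Euc d)) ≠ ⊤ := fun a b =>
    (measure_XuAdd_diff_lt_top μ hP a b).ne
  have h4 : μ.real (XuAdd P (b : Euc d) \ XuAdd P (a : Euc d)) = 0 ∨
      μ.real (XuAdd P (a : Euc d) \ XuAdd P (b : Euc d)) = 0 := by
    simpa using h3
  rcases h4 with h4 | h4
  · exact Or.inr ((measureReal_eq_zero_iff (hfin b a)).mp h4)
  · exact Or.inl ((measureReal_eq_zero_iff (hfin a b)).mp h4)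

end Unit

end Yu

/-! ### The cocycle along a ray -/

lemma eq_mul_of_add_of_nonneg {f : ℝ≥0 → ℝ} (hadd : ∀ s t, f (s + t) = f s + f t)
    (hf : ∀ s, 0 ≤ f s) (s : ℝ≥0) : f s = f 1 * s := by
  have hmono : Monotone f := fun s t hst => by
    rw [← add_tsub_cancel_of_le hst, hadd]
    exact le_add_of_nonneg_right (hf _)
  have h0 : f 0 = 0 := by simpa using hadd 0 0
  have hnat : ∀ (n : ℕ) (s : ℝ≥0), f (n * s) = n * f s := by
    intro n s
    induction n with
    | zero => simp [h0]
    | succ n ih => push_cast; rw [add_mul, hadd, one_mul, ih]; ring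
  have hnat1 : ∀ n : ℕ, f n = n * f 1 := fun n => by simpa using hnat n 1
  have hlim : Tendsto (fun n : ℕ => f 1 / (n : ℝ)) atTop (𝓝 0) :=
    tendsto_const_div_atTop_nhds_zero_nat _
  have hbound : ∀ᶠ n : ℕ in atTop, |f s - f 1 * s| ≤ f 1 / (n : ℝ) := by
    filter_upwards [eventually_ge_atTop 1] with n hn
    have hn0 : (0 : ℝ) < n := by exact_mod_cast hn
    set k := ⌊(n : ℝ≥0) * s⌋₊ with hk
    have h1 : (k : ℝ≥0) ≤ n * s := Nat.floor_le (by positivity)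
    have h2 : (n : ℝ≥0) * s ≤ ((k + 1 : ℕ) : ℝ≥0) := by
      push_cast
      exact (Nat.lt_floor_add_one _).le
    have h3 := hmono h1
    have h4 := hmono h2
    rw [hnat1, hnat] at h3
    rw [hnat1, hnat] at h4
    have h1' : (k : ℝ) ≤ n * s := by exact_mod_cast h1
    have h2' : (n : ℝ) * s ≤ k + 1 := by exact_mod_cast h2
    push_cast at h4
    have h5 := mul_le_mul_of_nonneg_right h1' (hf 1)
    have h6 := mul_le_mul_of_nonneg_right h2' (hf 1)
    have e : |f s - f 1 * s| * n = |(f s - f 1 * s) * n| := by rw [abs_mul, abs_of_pos hn0]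
    rw [le_div_iff₀ hn0, e, abs_le]
    constructor <;> linarith
  have h := le_of_tendsto_of_tendsto tendsto_const_nhds hlim hbound
  exact sub_eq_zero.mp (abs_nonpos_iff.mp h)

namespace Yu

variable {d : ℕ} {P : ProperCone ℝ (Euc d)}

/-- The point `s a` of the ray through `a`. -/
def rayPoint (a : P) (s : ℝ≥0) : P := ⟨(s : ℝ) • (a : Euc d), P.smul_mem a.2 s.2⟩

lemma rayPoint_add (a : P) (s t : ℝ≥0) : rayPoint a (s + t) = rayPoint a s + rayPoint a t :=
  Subtype.ext (add_smul (s : ℝ) (t : ℝ) (a : Euc d))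

lemma rayPoint_one (a : P) : rayPoint a 1 = a := Subtype.ext (one_smul ℝ (a : Euc d))

section Ray

variable (μ : Measure (Yu P)) [VAddInvariantMeasure (Euc d) (Yu P) μ]
  [IsFiniteMeasureOnCompacts μ] (hP : (P : Set (Euc d)) - (P : Set (Euc d)) = Set.univ)

lemma norm_sq_cocycle_add (a b : P) :
    ‖cocycle hP μ (a + b)‖ ^ 2 = ‖cocycle hP μ a‖ ^ 2 + ‖cocycle hP μ b‖ ^ 2 := by
  have h : ⟪cocycle hP μ a, shiftIsometry μ a (cocycle hP μ b)⟫_ℂ = 0 := by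
    have := ContinuousLinearMap.adjoint_inner_left (shiftIsometry μ a).toContinuousLinearMap
      (cocycle hP μ b) (cocycle hP μ a)
    rw [adjoint_cocycle, inner_zero_left] at this
    exact this.symm
  rw [cocycle_add, @norm_add_sq ℂ, h, LinearIsometry.norm_map]
  simp

/-- Along a ray, the cocycle has orthogonal increments of variance proportional to their length:
the variance is additive and nonnegative. -/
lemma isStationaryCocycle_ray (a : P) :
    IsStationaryCocycle (ray (shiftSemigroup μ) a) (fun s => cocycle hP μ (rayPoint a s))
      (‖cocycle hP μ a‖₊ ^ 2) where
  add s t := by rw [rayPoint_add]; exact cocycle_add μ hP _ _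
  adjoint_eq_zero s := adjoint_cocycle μ hP (rayPoint a s)
  norm_sq s := by
    have := eq_mul_of_add_of_nonneg (f := fun s => ‖cocycle hP μ (rayPoint a s)‖ ^ 2)
      (fun s t => by rw [rayPoint_add]; exact norm_sq_cocycle_add μ hP _ _)
      (fun s => by positivity) s
    rw [rayPoint_one] at this
    rw [this]
    push_cast
    rfl

end Ray

/-! ### Measures supported by the translates of a half-space -/

section HalfSpaceSupport

variable {lam : Euc d} (hlam : lam ∈ dualSphere P)

/-- The height `⟪lam, a⟫` of a point `a` of `P`. -/
def height (hlam : lam ∈ dualSphere P) (a : P) : ℝ≥0 := ⟨⟪lam, (a : Euc d)⟫_ℝ, hlam.1 a a.2⟩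

lemma coe_height (a : P) : (height hlam a : ℝ) = ⟪lam, (a : Euc d)⟫_ℝ := rfl

lemma height_add (a b : P) : height hlam (a + b) = height hlam a + height hlam b :=
  NNReal.eq (inner_add_right lam (a : Euc d) (b : Euc d))

lemma height_rayPoint (a : P) (s : ℝ≥0) : height hlam (rayPoint a s) = s * height hlam a :=
  NNReal.eq (real_inner_smul_right lam (a : Euc d) (s : ℝ))

lemma measurable_height : Measurable (height hlam) := by
  refine Measurable.subtype_mk ?_
  have hc : Continuous fun x : Euc d => ⟪lam, x⟫_ℝ := by fun_prop
  exact hc.measurable.comp measurable_subtype_coe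

lemma exists_height_eq_one (hP : (P : Set (Euc d)) - (P : Set (Euc d)) = Set.univ) :
    ∃ a : P, height hlam a = 1 := by
  obtain ⟨p, hp, q, hq, hpq⟩ : lam ∈ (P : Set (Euc d)) - (P : Set (Euc d)) := hP ▸ Set.mem_univ _
  have hpq : p - q = lam := hpq
  have h1 : ⟪lam, p⟫_ℝ - ⟪lam, q⟫_ℝ = 1 := by
    rw [← inner_sub_right, hpq, real_inner_self_eq_norm_sq, hlam.2, one_pow]
  have h2 : 0 ≤ ⟪lam, q⟫_ℝ := hlam.1 q hq
  have h3 : 0 < ⟪lam, p⟫_ℝ := by linarith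
  refine ⟨⟨(⟪lam, p⟫_ℝ)⁻¹ • p, P.smul_mem hp (by positivity)⟩, NNReal.eq ?_⟩
  rw [coe_height, real_inner_smul_right, inv_mul_cancel₀ h3.ne', NNReal.coe_one]

variable (μ : Measure (Yu P)) [VAddInvariantMeasure (Euc d) (Yu P) μ]
  (hae : ∀ᵐ A ∂μ, A ∈ halfSpaces P lam)

include hlam hae

lemma ae_vadd_eq {a b : P} (hab : height hlam a = height hlam b) :
    ∀ᵐ A ∂(μ.restrict (Xu P)), (-(a : Euc d)) +ᵥ A = (-(b : Euc d)) +ᵥ A := by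
  refine ae_restrict_of_ae ?_
  filter_upwards [hae] with A hA
  obtain ⟨c, hc⟩ := (mem_halfSpaces_iff hlam.2).mp hA
  have h : ⟪lam, (a : Euc d)⟫_ℝ = ⟪lam, (b : Euc d)⟫_ℝ := congrArg NNReal.toReal hab
  refine ext (Set.ext fun x => ?_)
  rw [mem_vadd, mem_vadd, hc, hc, inner_sub_right, inner_sub_right, inner_neg_right,
    inner_neg_right, h]

lemma shiftIsometry_eq_of_height {a b : P} (hab : height hlam a = height hlam b) :
    shiftIsometry μ a = shiftIsometry μ b := by
  refine LinearIsometry.ext fun f => Lp.ext ?_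
  refine (coeFn_shiftIsometry μ a f).trans (EventuallyEq.trans ?_ (coeFn_shiftIsometry μ b f).symm)
  filter_upwards [ae_vadd_eq hlam μ hae hab] with A hA
  rw [shiftFun, shiftFun, hA]

lemma cocycle_eq_of_height [IsFiniteMeasureOnCompacts μ]
    (hP : (P : Set (Euc d)) - (P : Set (Euc d)) = Set.univ) {a b : P}
    (hab : height hlam a = height hlam b) : cocycle hP μ a = cocycle hP μ b := by
  classical
  refine Lp.ext ((coeFn_cocycle μ hP a).trans
    (EventuallyEq.trans ?_ (coeFn_cocycle μ hP b).symm))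
  filter_upwards [ae_vadd_eq hlam μ hae hab] with A hA
  simp only [Set.indicator_apply, Set.mem_sdiff, mem_XuAdd, hA]

/-- If `μ` is supported by the translates of the half-space of `lam`, the exponentials form a unit:
they are the product integrals of a single one-parameter cocycle, at the times `⟪lam, a⟫`. -/
lemma isUnitOf_rayExp [IsFiniteMeasureOnCompacts μ]
    (hP : (P : Set (Euc d)) - (P : Set (Euc d)) = Set.univ) :
    IsUnitOf (shiftSemigroup μ)
      (fun a : P => rayExp (shiftSemigroup μ) a (cocycle hP μ a)) := by
  obtain ⟨a₀, ha₀⟩ := exists_height_eq_one hlam hP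
  set W := ray (shiftSemigroup μ) a₀ with hW
  have hη := isStationaryCocycle_ray μ hP a₀
  set c := ‖cocycle hP μ a₀‖₊ ^ 2 with hc
  set E := productExp W fun s => cocycle hP μ (rayPoint a₀ s) with hE
  have hheight : ∀ a : P, height hlam a = height hlam (rayPoint a₀ (height hlam a)) := by
    intro a
    rw [height_rayPoint, ha₀, mul_one]
  have hV : ∀ a : P, (shiftSemigroup μ).toFun a = W.toFun (height hlam a) := fun a =>
    shiftIsometry_eq_of_height hlam μ hae (hheight a)
  have hcoc : ∀ a : P, cocycle hP μ a = cocycle hP μ (rayPoint a₀ (height hlam a)) := fun a =>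
    cocycle_eq_of_height hlam μ hae hP (hheight a)
  have hexp : ∀ a : P, rayExp (shiftSemigroup μ) a (cocycle hP μ a) = E (height hlam a) := by
    intro a
    have hray : ∀ s, (ray (shiftSemigroup μ) a).toFun s = W.toFun (s * height hlam a) := by
      intro s
      rw [← height_rayPoint]
      exact hV (rayPoint a s)
    have hunit : IsExponentialUnit (ray (shiftSemigroup μ) a)
        (fun s => cocycle hP μ (rayPoint a s)) (‖cocycle hP μ a‖₊ ^ 2)
        (fun s => E (s * height hlam a)) :=
      { mem := fun s => by rw [hray]; exact hη.productExp_mem _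
        numProj_zero := fun s => hη.numProj_zero_productExp _
        numProj_one := fun s => by
          rw [hη.numProj_one_productExp, hcoc (rayPoint a s), height_rayPoint]
        norm_sq := fun s => by
          have h1 := hη.norm_sq (height hlam a)
          rw [← hcoc a] at h1
          rw [hη.norm_sq_productExp]
          push_cast
          rw [h1]
          congr 1
          ring
        mul := fun s t => by
          rw [hray, hη.productExp_add, add_mul] }
    have := hunit.oneParamExp_eq (isStationaryCocycle_ray μ hP a) 1
    rw [rayPoint_one, one_mul] at this
    exact this
  refine ⟨fun a => ?_, fun ψ => ?_, fun a => ?_, fun a b => ?_⟩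
  · rw [hexp, hV]
    exact hη.productExp_mem _
  · simp only [hexp]
    have h1 : Continuous fun s => ⟪ψ, E s⟫_ℂ := continuous_const.inner hη.continuous_productExp
    exact h1.measurable.comp (measurable_height hlam)
  · rw [hexp]
    intro h0
    have h1 := hη.norm_sq_productExp (height hlam a)
    rw [← hE, h0] at h1
    have h2 := Real.exp_pos (c * height hlam a)
    rw [← h1] at h2
    simp at h2
  · rw [hexp, hexp, hexp, hV, hη.productExp_add, height_add]

end HalfSpaceSupport

end Yu

end CARFlow

end

theorem theorem4p6 {d : ℕ} (hd : 1 ≤ d) (P : ProperCone ℝ (Euc d))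
    (hspan : (P : Set (Euc d)) - (P : Set (Euc d)) = Set.univ)
    (hpointed : (P : Set (Euc d)) ∩ -(P : Set (Euc d)) = {0})
    (μ : Measure (Yu P)) [μ.Regular] [VAddInvariantMeasure (Euc d) (Yu P) μ] (hμ : μ ≠ 0) :
    IsUnitOf (Yu.shiftSemigroup μ)
        (fun a : P => rayExp (Yu.shiftSemigroup μ) a (Yu.cocycle hspan μ a)) ↔
      ∃ lam ∈ Yu.dualSphere P, μ.support = Yu.halfSpaces P lam := by
  refine ⟨fun h => ?_, fun ⟨lam, hlam, hsupp⟩ => ?_⟩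
  · exact Yu.exists_support_eq_halfSpaces μ hμ fun A hA B hB =>
      Yu.support_total μ hspan (Yu.measure_diff_eq_zero_of_isUnitOf μ hspan h) hA hB
  · have hae : ∀ᵐ A ∂μ, A ∈ Yu.halfSpaces P lam := by
      rw [← hsupp]
      exact Measure.support_mem_ae_of_regular
    exact Yu.isUnitOf_rayExp hlam μ hae hspan
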